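/- **Distributed algorithms.** A distributed algorithm $\mathcal D=(S,s_0,\mathit{Reg},\Delta)$ has a finite set $S$ of states, $s_0\in S$, a nonempty finite set $\mathit{Reg}$ of registers and a nonempty finite set $\Delta$ of transitions $\langle s:\mathit{send};\mathit{rec};\mathit{guard};\mathit{update};\mathbf{goto}\ s'\rangle$, where send is $\mathbf{skip}$, $\mathbf{fwd}$, $\mathbf{left}!r$, $\mathbf{right}!r$ or $\mathbf{left}!r;\mathbf{right}!r'$; rec is $\mathbf{skip}$, $\mathbf{left}?r$, $\mathbf{right}?r$ or $\mathbf{left}?r;\mathbf{right}?r'$ with $r\ne r'$; guard is a finite set of tests $r<r'$, $r=r'$; update is a finite set of assignments $r:=r'$ in which no register occurs twice as a left-hand side. A transition is identified with the set of its source state, commands, tests, assignments and $\mathbf{goto}\ s'$. It is assumed that $\Delta$ contains a dummy transition $\mathsf t=\langle \mathsf s:\mathbf{skip};\mathbf{skip};\mathbf{skip};\mathbf{skip};\mathbf{goto}\ s_0\rangle$ whose source state $\mathsf s\neq s_0$ occurs in no other transition. A ring $\mathcal R=(n:p_1,\dots,p_n)$ consists of $n\ge1$ processes, arranged cyclically,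 with pairwise distinct pids $p_i\in\mathbb N$. A configuration gives each process $i$ a state $s_i$ and a register assignment $\rho_i:\mathit{Reg}\to\{p_1,\dots,p_n\}$; it is initial if $s_i=s_0$ and $\rho_i(r)=p_i$ for all $i,r$. For $t=(t_1,\dots,t_n)\in\Delta^n$, the content of $r$ at $i$ is sent to $r'$ at $j$ if $\mathbf{right}!r\in t_i$, $\mathbf{left}?r'\in t_j$ and $\mathbf{fwd}\in t_l$ for all $l$ strictly between $i$ and $j$ when going right from $i$ to $j$ (all $l\neq i$ if $i=j$), or symmetrically to the left. Let $\hat\rho_j(r')=\rho_i(r)$ if the content of $r$ at some $i$ is sent to $r'$ at $j$ (then $(i,r)$ is unique), and $\hat\rho_j(r')=\rho_j(r')$ otherwise. The round $C\stackrel{t}{\rightsquigarrow}C'$ is possible if, for all $j$: $s_j\in t_j$ and $(\mathbf{goto}\ s'_j)\in t_j$; all tests of $t_j$ hold for $\hat\rho_j$; and $\rho'_j(r)=\hat\rho_j(r')$ if $(r:=r')\in t_j$, $\rho'_j(r)=\hat\rho_j(r)$ if $t_j$ has no assignment to $r$. A run of length $k\ge1$ is a sequence $\chi=C_0\stackrel{t^1}{\rightsquigarrow}\cdots\stackrel{t^k}{\rightsquigarrow}C_k$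 with $C_0$ initial. Its positions are $(i,j)$ with $1\le i\le n$, $0\le j\le k$; $s_i^j$ and $\rho_i^j$ denote the state and registers of process $i$ in $C_j$. **Specifications.** Local and path DataPDL formulas are $$\phi::=\mathsf m\mid s\mid\neg\phi\mid\phi\wedge\phi\mid\phi\Rightarrow\phi\mid[\pi]\phi\mid\langle\pi\rangle r\bowtie\langle\pi'\rangle r',\qquad \pi::=\{\phi\}?\mid\epsilon\mid{\leftarrow}\mid{\rightarrow}\mid{\uparrow}\mid{\downarrow}\mid\pi+\pi\mid\pi\cdot\pi\mid\pi^*,$$ with $s\in S$, $r,r'\in\mathit{Reg}$, ${\bowtie}\in\{=,\ne,<,\le\}$. They are evaluated in a run $\chi$ with a marked process $m$, at a position $x=(i,j)$: $\mathsf m$ means $i=m$; $s$ means $s_i^j=s$; path formulas denote binary relations on positions, as usual in PDL, where $\rightarrow,\leftarrow$ move to the right or left neighbor in the ring (cyclically) and $\downarrow,\uparrow$ to the next or previous configuration; $[\pi]\phi$ means that $\phi$ holds at all positions $\pi$-reachable from $x$; $\langle\pi\rangle r\bowtie\langle\pi'\rangle r'$ means that some $(i_1,j_1)$ is $\pi$-reachable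 and some $(i_2,j_2)$ is $\pi'$-reachable from $x$ with $\rho_{i_1}^{j_1}(r)\bowtie\rho_{i_2}^{j_2}(r')$. Write $\mathcal D\models\Phi$, for $\Phi=\forall_{rings}\forall_{runs}\forall_{\mathsf m}\phi$, if $\chi,m,(m,0)\models\phi$ for all rings, all runs $\chi$ and all processes $m$, and $\mathcal D\models_b\Phi$ if this holds for all runs of length at most $b$. A path formula $\pi$ is unambiguous if, in every run of $\mathcal D$ with any marked process, at most one position is $\pi$-reachable from each position. $\Phi$ is in $\mathrm{DataPDL}^{\ominus}(\mathcal D)$ if, in every subformula $\langle\pi\rangle r\bowtie\langle\pi'\rangle r'$ of $\phi$ with ${\bowtie}\in\{<,\le\}$, $\pi$ and $\pi'$ are unambiguous, and no such subformula occurs in the scope of a negation, on the left-hand side of an implication, or within a test. **LCPDL.** A table $T=(n,k,\lambda)$ with $n,k\ge1$ labels each position of $\{1,\dots,n\}\times\{0,\dots,k\}$ with a transition in $\Delta$. Local LCPDL formulas are built from transitions $t\in\Delta$ (the label is $t$) and items $\gamma$, i.e. states, gotos, commands, tests, assignments ($\gamma$ belongs to the label), by $\neg$, $\wedge$, $\langle\pi\rangle\psi$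 and $\mathrm{loop}(\pi)$ (true at $x$ iff $(x,x)\in[\![\pi]\!]_T$). Path formulas are built from $\{\psi\}?$, $\epsilon$, $\rightarrow$, $\downarrow$ (not cyclic: they stay in the table) by $+$, $\cdot$, $^*$, converse $^{-1}$, and finite automata whose transitions are labeled with path formulas (relating $x,y$ if, for some word $\pi_1\dots\pi_\ell$ labeling an accepting path, $(x,y)\in[\![\pi_1\cdots\pi_\ell]\!]_T$). Let $L(\psi)$ be the set of tables $T$ with $T,(1,0)\models\psi$, and $L_b(\psi)$ the set of those with $k\le b$. Abbreviate $\langle\pi\rangle=\langle\pi\rangle\mathit{true}$, $[\pi]\psi=\neg\langle\pi\rangle\neg\psi$, $\pi^+=\pi\cdot\pi^*$, ${\leftarrow}={\rightarrow}^{-1}$, ${\uparrow}={\downarrow}^{-1}$, ${\hookrightarrow}={\rightarrow}+\{\neg\langle\rightarrow\rangle\}?\cdot{\leftarrow}^*\cdot\{\neg\langle\leftarrow\rangle\}?$ and ${\hookleftarrow}={\hookrightarrow}^{-1}$. **The formula $\psi_{\mathcal D}$.** For registers $r,r'$ let $$\begin{aligned}\mathit{msg}_{r,r'}={}&\{\mathbf{right}!r\}?\cdot({\hookrightarrow}\cdot\{\mathbf{fwd}\}?)^*\cdot{\hookrightarrow}\cdot\{\mathbf{left}?r'\}?\\&+\{\mathbf{left}!r\}?\cdot({\hookleftarrow}\cdot\{\mathbf{fwd}\}?)^*\cdot{\hookleftarrow}\cdot\{\mathbf{right}?r'\}?;\end{aligned}$$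 $\mathit{loc}_{r,r}=\{\bigwedge_{\bar r}\neg\langle(\mathit{msg}_{\bar r,r})^{-1}\rangle\}?$, $\mathit{upd}_{r,r}=\{\bigwedge_{\bar r\ne r}\neg(r:=\bar r)\}?$, $\mathit{next}_{r,r}={\downarrow}$; and, for $r\ne r'$, $\mathit{loc}_{r,r'}=\mathit{next}_{r,r'}=\{\mathit{false}\}?$, $\mathit{upd}_{r,r'}=\{r':=r\}?$. For $h\in\{1,2\}$, the automaton $\mathcal A^h_r$ has the states $\iota$ (initial) and $\{0,1,2\}\times\mathit{Reg}$, the final state $(h,r)$, transitions $\iota\to(0,q)$ labeled $\{\neg\langle\uparrow\rangle\}?$, and transitions from $(0,q)$ to $(1,q')$ labeled $\mathit{loc}_{q,q'}$ and labeled $\mathit{msg}_{q,q'}$, from $(1,q)$ to $(2,q')$ labeled $\mathit{upd}_{q,q'}$, and from $(2,q)$ to $(0,q')$ labeled $\mathit{next}_{q,q'}$, for all registers $q,q'$. Let $\psi_{\mathcal D}=\psi_=\wedge\psi_<\wedge\psi_{\mathsf{col}}$, where $$\psi_= = [({\rightarrow}+{\downarrow})^*]\bigwedge_{r,r'}\bigl(r=r'\Rightarrow\mathrm{loop}((\mathcal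 A^1_r)^{-1}\cdot\mathcal A^1_{r'})\bigr),$$ $$\psi_< = \neg\langle{\rightarrow}^*\rangle\mathrm{loop}(\pi_<),\qquad \pi_<=\Bigl(\sum_{r,r'}\mathcal A^1_r\cdot\{r<r'\}?\cdot(\mathcal A^1_{r'})^{-1}\Bigr)^+,$$ $$\psi_{\mathsf{col}}=[{\rightarrow}^*]\Bigl(\mathsf t\wedge[{\downarrow}^*]\bigwedge_{s\in S}\bigl(\mathbf{goto}\ s\Rightarrow[\downarrow]s\bigr)\Bigr).$$ **The translation $\widetilde\phi$.** It commutes with $\neg,\wedge,\Rightarrow$ and $[\cdot]$; $\widetilde{\mathsf m}=\neg\langle\leftarrow\rangle$; $\widetilde s=\mathbf{goto}\ s$; $\widetilde\pi$ replaces tests $\{\phi\}?$ by $\{\widetilde\phi\}?$, $\rightarrow$ by $\hookrightarrow$ and $\leftarrow$ by $\hookleftarrow$; and $\langle\pi\rangle r\bowtie\langle\pi'\rangle r'$ is translated to $$\mathrm{loop}\bigl(\widetilde\pi\cdot(\mathcal A^2_r)^{-1}\cdot\kappa_{\bowtie}\cdot\mathcal A^2_{r'}\cdot(\widetilde{\pi'})^{-1}\bigr),$$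 where $\kappa_<$ is $\pi_<$, $\kappa_\le$ is $\pi_<+\epsilon$, $\kappa_=$ is $\epsilon$ (i.e. omitted), and $\kappa_{\neq}$ is ${\leftarrow}^++{\rightarrow}^+$. **Lemma.** Let $\mathcal D$ be a distributed algorithm as above, $\Phi=\forall_{rings}\forall_{runs}\forall_{\mathsf m}\phi\in\mathrm{DataPDL}^{\ominus}(\mathcal D)$, and $b\ge1$. Then (a) $\mathcal D\models\Phi\iff L(\psi_{\mathcal D}\wedge\neg\widetilde\phi)=\emptyset$, and (b) $\mathcal D\models_b\Phi\iff L_b(\psi_{\mathcal D}\wedge\neg\widetilde\phi)=\emptyset$. -/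

import Mathlib

namespace RingAlg

/-! ## Distributed algorithms on rings -/

/-- `send ::= skip | fwd | left!r | right!r | left!r ; right!r'`. -/
inductive Send (Reg : Type) : Type
  | skip
  | fwd
  | left (r : Reg)
  | right (r : Reg)
  | both (r r' : Reg)

/-- `rec ::= skip | left?r | right?r | left?r ; right?r'`, the last one with `r ≠ r'`. -/
inductive Receive (Reg : Type) : Type
  | skip
  | left (r : Reg)
  | right (r : Reg)
  | both (r r' : Reg) (h : r ≠ r')

/-- Atomic guards `r < r'` and `r = r'`. -/
inductive Guard (Reg : Type) : Type
  | lt (r r' : Reg)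
  | eq (r r' : Reg)

/-- A transition. The guard is the finite set of its atomic guards (empty for `skip`); the update
is given by `update r = some r'` if it contains `r := r'`, and `update r = none` if `r` does not
occur as a left-hand side (so every register occurs at most once as a left-hand side). -/
structure Transition (S Reg : Type) : Type where
  src : S
  send : Send Reg
  recv : Receive Reg
  guards : Finset (Guard Reg)
  update : Reg → Option Reg
  tgt : S

/-- The states, commands, guards and updates that can occur in a transition. -/
inductive Item (S Reg : Type) : Type
  | state (s : S)
  | goto (s : S)
  | fwd
  | sendLeft (r : Reg)
  | sendRight (r : Reg)
  | recLeft (r : Reg)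
  | recRight (r : Reg)
  | lt (r r' : Reg)
  | eq (r r' : Reg)
  | upd (r r' : Reg)

/-- `t.Has γ` means `γ ∈ t`, where `t` is seen as the set of its items;
`upd r r'` is the update `r := r'`. -/
def Transition.Has {S Reg : Type} (t : Transition S Reg) : Item S Reg → Prop
  | .state s => t.src = s
  | .goto s => t.tgt = s
  | .fwd => t.send = .fwd
  | .sendLeft r => t.send = .left r ∨ ∃ r', t.send = .both r r'
  | .sendRight r => t.send = .right r ∨ ∃ r', t.send = .both r' r
  | .recLeft r => t.recv = .left r ∨ ∃ r' h, t.recv = .both r r' h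
  | .recRight r => t.recv = .right r ∨ ∃ r' h, t.recv = .both r' r h
  | .lt r r' => Guard.lt r r' ∈ t.guards
  | .eq r r' => Guard.eq r r' ∈ t.guards
  | .upd r r' => t.update r = some r'

/-- A distributed algorithm `(S, s₀, Reg, Δ)`. -/
structure DistAlg : Type 1 where
  S : Type
  Reg : Type
  finS : Fintype S
  finReg : Fintype Reg
  neReg : Nonempty Reg
  s₀ : S
  Δ : Finset (Transition S Reg)
  neΔ : Δ.Nonempty

attribute [instance] DistAlg.finS DistAlg.finReg DistAlg.neReg

/-- `t = ⟨s : skip; skip; skip; skip; goto s₀⟩`, where the state `s ≠ s₀` does not occur in any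
other transition. -/
structure DistAlg.IsDummy (D : DistAlg) (t : D.Δ) : Prop where
  src_ne : t.1.src ≠ D.s₀
  send : t.1.send = .skip
  recv : t.1.recv = .skip
  guards : t.1.guards = ∅
  update : ∀ r, t.1.update r = none
  tgt : t.1.tgt = D.s₀
  fresh : ∀ t' : D.Δ, t' ≠ t → t'.1.src ≠ t.1.src ∧ t'.1.tgt ≠ t.1.src

/-- A ring `(n : p₁, …, pₙ)`: `n ≥ 1` processes, indexed by `Fin n`, with distinct pids. -/
structure PidRing : Type where
  n : ℕ
  pos : 1 ≤ n
  pid : Fin n → ℕ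
  inj : Function.Injective pid

/-- `i'` is the right neighbor of `i` in a ring of `n` processes. -/
def IsRightNeighbor {n : ℕ} (i i' : Fin n) : Prop :=
  (i : ℕ) + 1 = i' ∨ ((i : ℕ) + 1 = n ∧ (i' : ℕ) = 0)

/-- The processes strictly between `i` and `j` when going to the right from `i` to `j`
(all processes other than `i`, if `i = j`). -/
def Between {n : ℕ} (i j : Fin n) : Set (Fin n) :=
  {l | if i < j then i < l ∧ l < j else l < j ∨ i < l}

section Semantics

variable {D : DistAlg}

/-- The content of `r` is sent to the right from `i` to `j`, where it is stored in `r'`. -/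
def SentRight {n : ℕ} (t : Fin n → D.Δ) (i : Fin n) (r : D.Reg) (j : Fin n) (r' : D.Reg) : Prop :=
  (t i).1.Has (.sendRight r) ∧ (t j).1.Has (.recLeft r') ∧ ∀ l ∈ Between i j, (t l).1.Has .fwd

/-- The content of `r` is sent to the left from `i` to `j`, where it is stored in `r'`. -/
def SentLeft {n : ℕ} (t : Fin n → D.Δ) (i : Fin n) (r : D.Reg) (j : Fin n) (r' : D.Reg) : Prop :=
  (t i).1.Has (.sendLeft r) ∧ (t j).1.Has (.recRight r') ∧ ∀ l ∈ Between j i, (t l).1.Has .fwd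

/-- A configuration of `D` over the ring `R`: states and register contents of all processes. -/
structure Config (D : DistAlg) (R : PidRing) : Type where
  state : Fin R.n → D.S
  reg : Fin R.n → D.Reg → Set.range R.pid

def Config.IsInitial {R : PidRing} (C : Config D R) : Prop :=
  ∀ i, C.state i = D.s₀ ∧ ∀ r, (C.reg i r : ℕ) = R.pid i

open Classical in
/-- The intermediate register assignment, after sending and receiving. The pair `(i, r)` that is
chosen below is unique if it exists. -/
noncomputable def Config.mid {R : PidRing} (C : Config D R) (t : Fin R.n → D.Δ)
    (j : Fin R.n) (r' : D.Reg) : Set.range R.pid :=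
  if h : ∃ p : Fin R.n × D.Reg, SentRight t p.1 p.2 j r' ∨ SentLeft t p.1 p.2 j r' then
    C.reg h.choose.1 h.choose.2
  else C.reg j r'

/-- One round: the relation `C ⇝ C'` labeled by the tuple of transitions `t`. -/
structure Step {R : PidRing} (t : Fin R.n → D.Δ) (C C' : Config D R) : Prop where
  src : ∀ j, (t j).1.Has (.state (C.state j))
  tgt : ∀ j, (t j).1.Has (.goto (C'.state j))
  lt : ∀ j r r', (t j).1.Has (.lt r r') → C.mid t j r < C.mid t j r'
  eq : ∀ j r r', (t j).1.Has (.eq r r') → C.mid t j r = C.mid t j r'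
  upd : ∀ j r r', (t j).1.Has (.upd r r') → C'.reg j r = C.mid t j r'
  keep : ∀ j r, (¬ ∃ r', (t j).1.Has (.upd r r')) → C'.reg j r = C.mid t j r

/-- A run of `D` of length `k ≥ 1` over the ring `R`. -/
structure Run (D : DistAlg) (R : PidRing) : Type where
  k : ℕ
  pos : 1 ≤ k
  conf : Fin (k + 1) → Config D R
  trans : Fin k → Fin R.n → D.Δ
  initial : (conf 0).IsInitial
  step : ∀ j : Fin k, Step (trans j) (conf j.castSucc) (conf j.succ)

/-- Positions: `n` columns (processes), and `k + 1` rows numbered `0, …, k`. -/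
abbrev Pos (n k : ℕ) : Type := Fin n × Fin (k + 1)

end Semantics

/-! ## DataPDL -/

/-- The comparisons `=`, `≠`, `<`, `≤`. -/
inductive Cmp : Type
  | eq
  | ne
  | lt
  | le

def Cmp.Holds {α : Type} [LinearOrder α] : Cmp → α → α → Prop
  | .eq, a, b => a = b
  | .ne, a, b => a ≠ b
  | .lt, a, b => a < b
  | .le, a, b => a ≤ b

mutual

/-- Local DataPDL formulas; `cmp c r r' π π'` is `⟨π⟩r ⋈ ⟨π'⟩r'`, where `⋈` is `c`. -/
inductive DForm (S Reg : Type) : Type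
  | mark
  | state (s : S)
  | neg (φ : DForm S Reg)
  | and (φ φ' : DForm S Reg)
  | imp (φ φ' : DForm S Reg)
  | box (π : DPath S Reg) (φ : DForm S Reg)
  | cmp (c : Cmp) (r r' : Reg) (π π' : DPath S Reg)

/-- DataPDL path formulas. -/
inductive DPath (S Reg : Type) : Type
  | test (φ : DForm S Reg)
  | stay
  | left
  | right
  | up
  | down
  | alt (π π' : DPath S Reg)
  | seq (π π' : DPath S Reg)
  | star (π : DPath S Reg)

end

section DataPDL

variable {D : DistAlg} {R : PidRing}

mutual

/-- `χ, m, x ⊨ φ`. -/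
def DForm.Sat (χ : Run D R) (m : Fin R.n) : DForm D.S D.Reg → Pos R.n χ.k → Prop
  | .mark, x => x.1 = m
  | .state s, x => (χ.conf x.2).state x.1 = s
  | .neg φ, x => ¬ φ.Sat χ m x
  | .and φ φ', x => φ.Sat χ m x ∧ φ'.Sat χ m x
  | .imp φ φ', x => φ.Sat χ m x → φ'.Sat χ m x
  | .box π φ, x => ∀ y, π.Rel χ m x y → φ.Sat χ m y
  | .cmp c r r' π π', x => ∃ y y', π.Rel χ m x y ∧ π'.Rel χ m x y' ∧
      c.Holds ((χ.conf y.2).reg y.1 r) ((χ.conf y'.2).reg y'.1 r')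

/-- `(x, y) ∈ ⟦π⟧`, in the run `χ` with marked process `m`. -/
def DPath.Rel (χ : Run D R) (m : Fin R.n) :
    DPath D.S D.Reg → Pos R.n χ.k → Pos R.n χ.k → Prop
  | .test φ, x, y => x = y ∧ φ.Sat χ m x
  | .stay, x, y => x = y
  | .left, x, y => IsRightNeighbor y.1 x.1 ∧ x.2 = y.2
  | .right, x, y => IsRightNeighbor x.1 y.1 ∧ x.2 = y.2
  | .up, x, y => x.1 = y.1 ∧ (y.2 : ℕ) + 1 = x.2
  | .down, x, y => x.1 = y.1 ∧ (x.2 : ℕ) + 1 = y.2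
  | .alt π π', x, y => π.Rel χ m x y ∨ π'.Rel χ m x y
  | .seq π π', x, y => ∃ z, π.Rel χ m x z ∧ π'.Rel χ m z y
  | .star π, x, y => Relation.ReflTransGen (fun u v => π.Rel χ m u v) x y

end

/-- `D ⊨ ∀rings ∀runs ∀m φ`. -/
def DistAlg.Models (D : DistAlg) (φ : DForm D.S D.Reg) : Prop :=
  ∀ (R : PidRing) (χ : Run D R) (m : Fin R.n), φ.Sat χ m (m, 0)

/-- `D ⊨_b ∀rings ∀runs ∀m φ`: the same, for the runs of length at most `b` only. -/
def DistAlg.ModelsUpTo (D : DistAlg) (b : ℕ) (φ : DForm D.S D.Reg) : Prop :=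
  ∀ (R : PidRing) (χ : Run D R), χ.k ≤ b → ∀ m : Fin R.n, φ.Sat χ m (m, 0)

/-- From any position, in any run, `π` leads to at most one position. -/
def DPath.Unambiguous (D : DistAlg) (π : DPath D.S D.Reg) : Prop :=
  ∀ (R : PidRing) (χ : Run D R) (m : Fin R.n) (x y y' : Pos R.n χ.k),
    π.Rel χ m x y → π.Rel χ m x y' → y = y'

end DataPDL

/-- `c` is one of `<`, `≤`. -/
def Cmp.IsOrder : Cmp → Prop
  | .eq => False
  | .ne => False
  | .lt => True
  | .le => True

mutual

/-- No subformula, at any depth, is a comparison with `<` or `≤`. -/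
def DForm.NoOrder {S Reg : Type} : DForm S Reg → Prop
  | .mark => True
  | .state _ => True
  | .neg φ => φ.NoOrder
  | .and φ φ' => φ.NoOrder ∧ φ'.NoOrder
  | .imp φ φ' => φ.NoOrder ∧ φ'.NoOrder
  | .box π φ => π.NoOrder ∧ φ.NoOrder
  | .cmp c _ _ π π' => ¬ c.IsOrder ∧ π.NoOrder ∧ π'.NoOrder

/-- The tests in the path formula contain no comparison with `<` or `≤`. -/
def DPath.NoOrder {S Reg : Type} : DPath S Reg → Prop
  | .test φ => φ.NoOrder
  | .stay => True
  | .left => True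
  | .right => True
  | .up => True
  | .down => True
  | .alt π π' => π.NoOrder ∧ π'.NoOrder
  | .seq π π' => π.NoOrder ∧ π'.NoOrder
  | .star π => π.NoOrder

end

/-- The formula belongs to the restricted logic (DataPDL with the superscript `⊖`): comparisons
with `<` or `≤` have unambiguous path formulas, and do not occur in the scope of a negation, on
the left-hand side of an implication, or within a test. -/
def DForm.Restricted (D : DistAlg) : DForm D.S D.Reg → Prop
  | .mark => True
  | .state _ => True
  | .neg φ => φ.NoOrder
  | .and φ φ' => φ.Restricted D ∧ φ'.Restricted D
  | .imp φ φ' => φ.NoOrder ∧ φ'.Restricted D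
  | .box π φ => π.NoOrder ∧ φ.Restricted D
  | .cmp c _ _ π π' => π.NoOrder ∧ π'.NoOrder ∧
      (c.IsOrder → π.Unambiguous D ∧ π'.Unambiguous D)

/-! ## LCPDL: PDL with loop and converse over tables -/

/-- A table of width `n ≥ 1` and height `k ≥ 1` (with `k + 1` rows) over the alphabet `Δ`. -/
structure Table (D : DistAlg) : Type where
  n : ℕ
  k : ℕ
  n_pos : 1 ≤ n
  k_pos : 1 ≤ k
  lab : Fin n → Fin (k + 1) → D.Δ

mutual

/-- Local LCPDL formulas; `dia π ψ` is `⟨π⟩ψ`. -/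
inductive LForm (D : DistAlg) : Type 1
  | trans (t : D.Δ)
  | item (γ : Item D.S D.Reg)
  | neg (ψ : LForm D)
  | and (ψ ψ' : LForm D)
  | dia (π : LPath D) (ψ : LForm D)
  | loop (π : LPath D)

/-- LCPDL path formulas. `aut` is a path automaton: a finite automaton with states `Q`, initial
state `q₀`, final states `F`, and a transition from `src e` to `tgt e` labeled with the path
formula `label e` for every `e : E`. -/
inductive LPath (D : DistAlg) : Type 1
  | test (ψ : LForm D)
  | stay
  | right
  | down
  | alt (π π' : LPath D)
  | seq (π π' : LPath D)
  | star (π : LPath D)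
  | conv (π : LPath D)
  | aut (Q E : Type) (finQ : Finite Q) (finE : Finite E) (q₀ : Q) (F : Set Q)
      (src tgt : E → Q) (label : E → LPath D)

end

/-- The word `w` over the set `E` of transitions of an automaton is a path from `q` to `q'`. -/
def IsAutPath {Q E : Type} (src tgt : E → Q) : Q → List E → Q → Prop
  | q, [], q' => q = q'
  | q, e :: w, q' => src e = q ∧ IsAutPath src tgt (tgt e) w q'

/-- Composition of the relations `rel e` along the word `w`. -/
def compWord {E α : Type} (rel : E → α → α → Prop) : List E → α → α → Prop
  | [], x, y => x = y
  | e :: w, x, y => ∃ z, rel e x z ∧ compWord rel w z y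

section LCPDL

variable {D : DistAlg}

mutual

/-- `T, x ⊨ ψ`. -/
def LForm.Sat (T : Table D) : LForm D → Pos T.n T.k → Prop
  | .trans t, x => T.lab x.1 x.2 = t
  | .item γ, x => (T.lab x.1 x.2).1.Has γ
  | .neg ψ, x => ¬ ψ.Sat T x
  | .and ψ ψ', x => ψ.Sat T x ∧ ψ'.Sat T x
  | .dia π ψ, x => ∃ y, π.Rel T x y ∧ ψ.Sat T y
  | .loop π, x => π.Rel T x x

/-- `(x, y) ∈ ⟦π⟧`, in the table `T`. -/
def LPath.Rel (T : Table D) : LPath D → Pos T.n T.k → Pos T.n T.k → Prop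
  | .test ψ, x, y => x = y ∧ ψ.Sat T x
  | .stay, x, y => x = y
  | .right, x, y => (x.1 : ℕ) + 1 = y.1 ∧ x.2 = y.2
  | .down, x, y => x.1 = y.1 ∧ (x.2 : ℕ) + 1 = y.2
  | .alt π π', x, y => π.Rel T x y ∨ π'.Rel T x y
  | .seq π π', x, y => ∃ z, π.Rel T x z ∧ π'.Rel T z y
  | .star π, x, y => Relation.ReflTransGen (fun u v => π.Rel T u v) x y
  | .conv π, x, y => π.Rel T y x
  | .aut _ _ _ _ q₀ F src tgt label, x, y =>
      ∃ w q, q ∈ F ∧ IsAutPath src tgt q₀ w q ∧ compWord (fun e => (label e).Rel T) w x y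

end

/-- `L(ψ)`: the tables that satisfy `ψ` in the first column of row `0`. -/
def LForm.lang (ψ : LForm D) : Set (Table D) :=
  {T | ψ.Sat T (⟨0, T.n_pos⟩, 0)}

/-- `L_b(ψ)`: the tables in `L(ψ)` of height at most `b`. -/
def LForm.langUpTo (b : ℕ) (ψ : LForm D) : Set (Table D) :=
  {T | T ∈ ψ.lang ∧ T.k ≤ b}

/-! ### Abbreviations -/

def LForm.false : LForm D :=
  .and (.item (.state D.s₀)) (.neg (.item (.state D.s₀)))

def LForm.true : LForm D := .neg LForm.false

def LForm.imp (ψ ψ' : LForm D) : LForm D := .neg (.and ψ (.neg ψ'))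

def LForm.box (π : LPath D) (ψ : LForm D) : LForm D := .neg (.dia π (.neg ψ))

/-- `⟨π⟩`, that is, `⟨π⟩true`. -/
def LForm.ex (π : LPath D) : LForm D := .dia π .true

/-- Finite conjunction. -/
def LForm.conj : List (LForm D) → LForm D
  | [] => .true
  | ψ :: l => .and ψ (LForm.conj l)

/-- Conjunction of the formulas `f a`, for all elements `a` of a finite type. -/
noncomputable def LForm.conjAll {α : Type} [Fintype α] (f : α → LForm D) : LForm D :=
  LForm.conj ((Finset.univ : Finset α).toList.map f)

/-- Finite sum. -/
def LPath.sum : List (LPath D) → LPath D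
  | [] => .test .false
  | π :: l => .alt π (LPath.sum l)

/-- Sum of the path formulas `f a`, for all elements `a` of a finite type. -/
noncomputable def LPath.sumAll {α : Type} [Fintype α] (f : α → LPath D) : LPath D :=
  LPath.sum ((Finset.univ : Finset α).toList.map f)

def LPath.plus (π : LPath D) : LPath D := .seq π (.star π)

def LPath.left : LPath D := .conv .right

def LPath.up : LPath D := .conv .down

/-- `→ + {¬⟨→⟩}? ←* {¬⟨←⟩}?`: one step to the right in the ring. -/
def LPath.cycRight : LPath D :=
  .alt .right
    (.seq (.test (.neg (.ex .right))) (.seq (.star .left) (.test (.neg (.ex .left)))))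

/-- One step to the left in the ring. -/
def LPath.cycLeft : LPath D := .conv .cycRight

end LCPDL

/-! ## From distributed algorithms to LCPDL -/

section Translation

variable {D : DistAlg}

/-- Transmission of a pid by messages, from register `r` (after sending) to `r'` (after
receiving). -/
def msgPath (r r' : D.Reg) : LPath D :=
  .alt
    (.seq (.test (.item (.sendRight r)))
      (.seq (.star (.seq .cycRight (.test (.item .fwd))))
        (.seq .cycRight (.test (.item (.recLeft r'))))))
    (.seq (.test (.item (.sendLeft r)))
      (.seq (.star (.seq .cycLeft (.test (.item .fwd))))
        (.seq .cycLeft (.test (.item (.recRight r'))))))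

open Classical in
/-- The content of a register is not affected by reception. -/
noncomputable def locPath (r r' : D.Reg) : LPath D :=
  if r = r' then .test (LForm.conjAll fun q : D.Reg => .neg (.ex (.conv (msgPath q r))))
  else .test .false

open Classical in
/-- The effect of updates: the content of `r` is copied to `r'`, or `r = r'` is kept. -/
noncomputable def updPath (r r' : D.Reg) : LPath D :=
  if r = r' then
    .test (LForm.conjAll fun q : {q : D.Reg // q ≠ r} => .neg (.item (.upd r q.1)))
  else .test (.item (.upd r' r))

open Classical in
/-- Switch to the next transition of the same process. -/
noncomputable def nextPath (r r' : D.Reg) : LPath D :=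
  if r = r' then .down else .test .false

inductive Theta : Type
  | loc
  | msg
  | upd
  | next

/-- The stage at which `θ` starts: `0` is after sending, `1` after receiving, `2` after update. -/
def Theta.stage : Theta → Fin 3
  | .loc => 0
  | .msg => 0
  | .upd => 1
  | .next => 2

/-- The stage at which `θ` ends. -/
def Theta.stage' : Theta → Fin 3
  | .loc => 1
  | .msg => 1
  | .upd => 2
  | .next => 0

instance : Finite Theta :=
  Finite.of_injective
    (fun θ : Theta => match θ with
      | .loc => (0 : Fin 4) | .msg => 1 | .upd => 2 | .next => 3)
    (by intro a b h; cases a <;> cases b <;> simp_all)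

noncomputable def Theta.path : Theta → D.Reg → D.Reg → LPath D
  | .loc => locPath
  | .msg => msgPath
  | .upd => updPath
  | .next => nextPath

/-- The path automaton for stage `h` and register `r`. Its states are `ι = none` and the pairs of
a stage and a register. There are transitions `ι → (0, q)` labeled `{¬⟨↑⟩}?`, for every `q`, and
transitions `(h₁, q) → (h₂, q')` labeled `θ_{q,q'}`, where `θ` goes from stage `h₁` to `h₂`. -/
noncomputable def traceAut (h : Fin 3) (r : D.Reg) : LPath D :=
  .aut (Option (Fin 3 × D.Reg)) (D.Reg ⊕ (Theta × D.Reg × D.Reg))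
    inferInstance
    inferInstance
    none {some (h, r)}
    (Sum.elim (fun _ => none) (fun e => some (e.1.stage, e.2.1)))
    (Sum.elim (fun q => some (0, q)) (fun e => some (e.1.stage', e.2.2)))
    (Sum.elim (fun _ => .test (.neg (.ex .up))) (fun e => e.1.path e.2.1 e.2.2))

/-- Consistency of equality guards. -/
noncomputable def psiEq (D : DistAlg) : LForm D :=
  .box (.star (.alt .right .down)) <|
    LForm.conjAll fun p : D.Reg × D.Reg =>
      .imp (.item (.eq p.1 p.2)) (.loop (.seq (.conv (traceAut 1 p.1)) (traceAut 1 p.2)))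

/-- Connects `(i, 0)` with `(i', 0)` if the guards force the pid of `i` to be smaller than the
pid of `i'`. -/
noncomputable def piLt (D : DistAlg) : LPath D :=
  .plus <| LPath.sumAll fun p : D.Reg × D.Reg =>
    .seq (traceAut 1 p.1) (.seq (.test (.item (.lt p.1 p.2))) (.conv (traceAut 1 p.2)))

/-- Consistency of `<`-guards. -/
noncomputable def psiLt (D : DistAlg) : LForm D :=
  .neg (.dia (.star .right) (.loop (piLt D)))

/-- Every column starts with the dummy transition `t`, and each further transition starts in the
target state of the previous one. -/
noncomputable def psiCol (D : DistAlg) (t : D.Δ) : LForm D :=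
  .box (.star .right) <| .and (.trans t) <|
    .box (.star .down) <|
      LForm.conjAll fun s : D.S => .imp (.item (.goto s)) (.box .down (.item (.state s)))

/-- The formula that describes the symbolic runs of `D`. -/
noncomputable def psiAlg (D : DistAlg) (t : D.Δ) : LForm D :=
  .and (psiEq D) (.and (psiLt D) (psiCol D t))

/-- For `⟨π⟩r ⋈ ⟨π'⟩r'`: connects two positions if, in the symbolic run, the content of `r` at the
first one and the content of `r'` at the second one are forced to be related by `⋈`. -/
noncomputable def Cmp.evidence (r r' : D.Reg) : Cmp → LPath D
  | .eq => .seq (.conv (traceAut 2 r)) (traceAut 2 r')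
  | .ne => .seq (.conv (traceAut 2 r)) (.seq (.alt (.plus .left) (.plus .right)) (traceAut 2 r'))
  | .lt => .seq (.conv (traceAut 2 r)) (.seq (piLt D) (traceAut 2 r'))
  | .le => .seq (.conv (traceAut 2 r)) (.seq (.alt (piLt D) .stay) (traceAut 2 r'))

mutual

/-- The translation of local formulas into LCPDL. -/
noncomputable def DForm.transl : DForm D.S D.Reg → LForm D
  | .mark => .neg (.ex .left)
  | .state s => .item (.goto s)
  | .neg φ => .neg φ.transl
  | .and φ φ' => .and φ.transl φ'.transl
  | .imp φ φ' => .imp φ.transl φ'.transl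
  | .box π φ => .box π.transl φ.transl
  | .cmp c r r' π π' =>
      .loop (.seq π.transl (.seq (c.evidence r r') (.conv π'.transl)))

/-- The translation of path formulas into LCPDL. -/
noncomputable def DPath.transl : DPath D.S D.Reg → LPath D
  | .test φ => .test φ.transl
  | .stay => .stay
  | .left => .cycLeft
  | .right => .cycRight
  | .up => .up
  | .down => .down
  | .alt π π' => .alt π.transl π'.transl
  | .seq π π' => .seq π.transl π'.transl
  | .star π => .star π.transl

end

end Translation

end RingAlg

namespace RingAlg

open Relation

section Ring

variable {n : ℕ}

theorem isRightNeighbor_iff_add_one [NeZero n] (i i' : Fin n) :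
    IsRightNeighbor i i' ↔ i' = i + 1 := by
  have h := i.2
  have h' := i'.2
  rw [Fin.ext_iff, Fin.val_add, IsRightNeighbor]
  rcases Nat.lt_or_ge 1 n with hn | hn
  · rw [Fin.val_one', Nat.mod_eq_of_lt hn]
    rcases Nat.lt_or_ge ((i : ℕ) + 1) n with h1 | h1
    · rw [Nat.mod_eq_of_lt h1]; omega
    · have : (i : ℕ) + 1 = n := by omega
      rw [this, Nat.mod_self]; omega
  · have : n = 1 := by omega
    subst this
    simp

theorem isRightNeighbor_rev (i i' : Fin n) :
    IsRightNeighbor i'.rev i.rev ↔ IsRightNeighbor i i' := by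
  simp only [IsRightNeighbor, Fin.val_rev]
  omega

theorem rev_mem_between (i j l : Fin n) : l.rev ∈ Between j.rev i.rev ↔ l ∈ Between i j := by
  simp only [Between, Set.mem_ofPred_eq, Fin.rev_lt_rev]
  split_ifs <;> tauto

/-- If a path to the right from `i` through processes in `F` ends at the left neighbor of `j`, then
all processes between `i` and `j` are in `F`. -/
theorem between_of_path {F : Fin n → Prop} {i z j : Fin n} (hi : ¬ F i)
    (h : ReflTransGen (fun u v => IsRightNeighbor u v ∧ F v) i z) (hz : IsRightNeighbor z j) :
    ∀ l ∈ Between i j, F l := by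
  have key : ∀ l : Fin n, (if i ≤ z then i < l ∧ l ≤ z else i < l ∨ l ≤ z) → F l := by
    clear hz
    induction h with
    | refl => intro l hl; simp at hl; exact absurd hl.1 (not_lt.2 hl.2)
    | @tail u v _ huv ih =>
      intro l hl
      by_cases hlv : l = v
      · exact hlv ▸ huv.2
      · apply ih
        have hvi : v ≠ i := fun h => hi (h ▸ huv.2)
        have := huv.1
        simp only [IsRightNeighbor, Fin.ext_iff, Fin.lt_def, Fin.le_def, ne_eq] at *
        split_ifs at hl ⊢ <;> omega
  intro l hl
  apply key
  simp only [IsRightNeighbor, Between, Set.mem_ofPred_eq, Fin.lt_def, Fin.le_def] at *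
  split_ifs at hl ⊢ <;> omega

theorem path_of_between {F : Fin n → Prop} {i j : Fin n} (h : ∀ l ∈ Between i j, F l) :
    ∃ z, ReflTransGen (fun u v => IsRightNeighbor u v ∧ F v) i z ∧ IsRightNeighbor z j := by
  have up : ∀ (a : Fin n) (d : ℕ) (hd : (a : ℕ) + d < n),
      (∀ l : Fin n, a < l → (l : ℕ) ≤ a + d → F l) →
      ReflTransGen (fun u v => IsRightNeighbor u v ∧ F v) a ⟨a + d, hd⟩ := by
    intro a d
    induction d with
    | zero => intro _ _; exact .refl
    | succ d ih =>
      intro hd hF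
      refine (ih (by omega) fun l h1 h2 => hF l h1 (by omega)).tail ⟨Or.inl ?_, hF _ ?_ le_rfl⟩
      · simp only; omega
      · simp only [Fin.lt_def]; omega
  have hi := i.2
  have hj := j.2
  by_cases hij : i < j
  · have hlt : (i : ℕ) + (j - 1 - i) < n := by omega
    refine ⟨_, up i _ hlt ?_, ?_⟩
    · intro l h1 h2
      apply h
      simp only [Between, Set.mem_ofPred_eq, Fin.lt_def] at *
      rw [if_pos hij]; omega
    · simp only [IsRightNeighbor, Fin.lt_def] at *; omega
  · have hF : ∀ l : Fin n, l < j ∨ i < l → F l := by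
      intro l hl
      apply h
      simpa [Between, hij] using hl
    have p1 := up i (n - 1 - i) (by omega) fun l h1 _ => hF l (Or.inr h1)
    by_cases hj0 : (j : ℕ) = 0
    · exact ⟨_, p1, Or.inr ⟨by simp only; omega, hj0⟩⟩
    · have p2 := up ⟨0, by omega⟩ (j - 1) (by simp only; omega) fun l _ h2 => hF l (Or.inl (by
        simp only [Fin.lt_def] at *; omega))
      refine ⟨_, (p1.tail ⟨Or.inr ⟨by simp only; omega, rfl⟩, hF _ (Or.inl ?_)⟩).trans p2,
        Or.inl (by simp only; omega)⟩
      simp only [Fin.lt_def]; omega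

theorem forall_between_iff {F : Fin n → Prop} {i j : Fin n} (hi : ¬ F i) :
    (∀ l ∈ Between i j, F l) ↔
      ∃ z, ReflTransGen (fun u v => IsRightNeighbor u v ∧ F v) i z ∧ IsRightNeighbor z j :=
  ⟨path_of_between, fun ⟨_, h, hz⟩ => between_of_path hi h hz⟩

theorem forall_between_iff' {F : Fin n → Prop} {i j : Fin n} (hi : ¬ F i) :
    (∀ l ∈ Between j i, F l) ↔
      ∃ z, ReflTransGen (fun u v => IsRightNeighbor v u ∧ F v) i z ∧ IsRightNeighbor j z := by
  have h := forall_between_iff (F := fun l => F l.rev) (i := i.rev) (j := j.rev)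
    (by rwa [Fin.rev_rev])
  have h1 : (∀ l ∈ Between j i, F l) ↔ ∀ l ∈ Between i.rev j.rev, F l.rev := by
    constructor
    · intro h l hl
      apply h
      rwa [← rev_mem_between, Fin.rev_rev]
    · intro h l hl
      have := h l.rev ((rev_mem_between ..).2 hl)
      rwa [Fin.rev_rev] at this
  rw [h1, h]
  constructor
  · rintro ⟨z, hz, hzj⟩
    refine ⟨z.rev, ?_, ?_⟩
    · have : ReflTransGen (fun u v => IsRightNeighbor v u ∧ F v) i.rev.rev z.rev :=
        hz.lift _ fun a b hab => ⟨(isRightNeighbor_rev ..).2 hab.1, hab.2⟩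
      rwa [Fin.rev_rev] at this
    · rwa [← isRightNeighbor_rev, Fin.rev_rev]
  · rintro ⟨z, hz, hzj⟩
    exact ⟨z.rev, hz.lift _ fun a b hab =>
      ⟨(isRightNeighbor_rev ..).2 hab.1, by rw [Fin.rev_rev]; exact hab.2⟩,
      (isRightNeighbor_rev ..).2 hzj⟩

end Ring

section Messages

variable {D : DistAlg} {n n' : ℕ}

/-- The content of `r` is sent from `i` to `j`, where it is stored in `r'`. -/
def Sent (t : Fin n → D.Δ) (i : Fin n) (r : D.Reg) (j : Fin n) (r' : D.Reg) : Prop :=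
  SentRight t i r j r' ∨ SentLeft t i r j r'

theorem Transition.Has.not_fwd_of_sendRight {S Reg : Type} {t : Transition S Reg} {r : Reg}
    (h : t.Has (.sendRight r)) : ¬ t.Has .fwd := by
  rcases h with h | ⟨_, h⟩ <;> simp [Transition.Has, h]

theorem Transition.Has.not_fwd_of_sendLeft {S Reg : Type} {t : Transition S Reg} {r : Reg}
    (h : t.Has (.sendLeft r)) : ¬ t.Has .fwd := by
  rcases h with h | ⟨_, h⟩ <;> simp [Transition.Has, h]

theorem Transition.Has.sendRight_inj {S Reg : Type} {t : Transition S Reg} {r r' : Reg}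
    (h : t.Has (.sendRight r)) (h' : t.Has (.sendRight r')) : r = r' := by
  rcases h with h | ⟨_, h⟩ <;> rcases h' with h' | ⟨_, h'⟩ <;> rw [h] at h' <;> cases h' <;> rfl

theorem Transition.Has.sendLeft_inj {S Reg : Type} {t : Transition S Reg} {r r' : Reg}
    (h : t.Has (.sendLeft r)) (h' : t.Has (.sendLeft r')) : r = r' := by
  rcases h with h | ⟨_, h⟩ <;> rcases h' with h' | ⟨_, h'⟩ <;> rw [h] at h' <;> cases h' <;> rfl

theorem Transition.Has.recLeft_ne_recRight {S Reg : Type} {t : Transition S Reg} {r r' : Reg}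
    (h : t.Has (.recLeft r)) (h' : t.Has (.recRight r')) : r ≠ r' := by
  rcases h with h | ⟨_, hne, h⟩ <;> rcases h' with h' | ⟨_, _, h'⟩ <;> rw [h] at h' <;> cases h'
  exact hne

theorem sentRight_iff_path {t : Fin n → D.Δ} {i j : Fin n} {r r' : D.Reg} :
    SentRight t i r j r' ↔ (t i).1.Has (.sendRight r) ∧ (t j).1.Has (.recLeft r') ∧
      ∃ z, ReflTransGen (fun u v => IsRightNeighbor u v ∧ (t v).1.Has .fwd) i z ∧
        IsRightNeighbor z j :=
  and_congr_right fun h => and_congr_right fun _ =>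
    forall_between_iff (F := fun l => (t l).1.Has .fwd) h.not_fwd_of_sendRight

theorem sentLeft_iff_path {t : Fin n → D.Δ} {i j : Fin n} {r r' : D.Reg} :
    SentLeft t i r j r' ↔ (t i).1.Has (.sendLeft r) ∧ (t j).1.Has (.recRight r') ∧
      ∃ z, ReflTransGen (fun u v => IsRightNeighbor v u ∧ (t v).1.Has .fwd) i z ∧
        IsRightNeighbor j z :=
  and_congr_right fun h => and_congr_right fun _ =>
    forall_between_iff' (F := fun l => (t l).1.Has .fwd) h.not_fwd_of_sendLeft

theorem Sent.map {t : Fin n → D.Δ} {t' : Fin n' → D.Δ} {e : Fin n → Fin n'}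
    (he : ∀ i i', IsRightNeighbor i i' → IsRightNeighbor (e i) (e i')) (ht : ∀ i, t' (e i) = t i)
    {i j : Fin n} {r r' : D.Reg} (h : Sent t i r j r') : Sent t' (e i) r (e j) r' := by
  rcases h with h | h
  · left
    rw [sentRight_iff_path] at h ⊢
    obtain ⟨h1, h2, z, h3, h4⟩ := h
    rw [ht, ht]
    exact ⟨h1, h2, e z, h3.lift e fun a b hab => ⟨he _ _ hab.1, by rw [ht]; exact hab.2⟩,
      he _ _ h4⟩
  · right
    rw [sentLeft_iff_path] at h ⊢
    obtain ⟨h1, h2, z, h3, h4⟩ := h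
    rw [ht, ht]
    exact ⟨h1, h2, e z, h3.lift e fun a b hab => ⟨he _ _ hab.1, by rw [ht]; exact hab.2⟩,
      he _ _ h4⟩

theorem mem_between_or_mem_between {i i' : Fin n} (j : Fin n) (h : i ≠ i') :
    i ∈ Between i' j ∨ i' ∈ Between i j := by
  simp only [Between, Set.mem_ofPred_eq, Fin.lt_def, ne_eq, Fin.ext_iff] at *
  split_ifs <;> omega

theorem mem_between_or_mem_between' {i i' : Fin n} (j : Fin n) (h : i ≠ i') :
    i ∈ Between j i' ∨ i' ∈ Between j i := by
  simp only [Between, Set.mem_ofPred_eq, Fin.lt_def, ne_eq, Fin.ext_iff] at *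
  split_ifs <;> omega

theorem Sent.unique {t : Fin n → D.Δ} {i i' j : Fin n} {r r' q : D.Reg} (h : Sent t i r j q)
    (h' : Sent t i' r' j q) : i = i' ∧ r = r' := by
  rcases h with ⟨h1, h2, h3⟩ | ⟨h1, h2, h3⟩ <;> rcases h' with ⟨h1', h2', h3'⟩ | ⟨h1', h2', h3'⟩
  · have : i = i' := by
      by_contra hne
      rcases mem_between_or_mem_between j hne with hm | hm
      · exact h1.not_fwd_of_sendRight (h3' _ hm)
      · exact h1'.not_fwd_of_sendRight (h3 _ hm)
    subst this
    exact ⟨rfl, h1.sendRight_inj h1'⟩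
  · exact absurd rfl (h2.recLeft_ne_recRight h2')
  · exact absurd rfl (h2'.recLeft_ne_recRight h2)
  · have : i = i' := by
      by_contra hne
      rcases mem_between_or_mem_between' j hne with hm | hm
      · exact h1.not_fwd_of_sendLeft (h3' _ hm)
      · exact h1'.not_fwd_of_sendLeft (h3 _ hm)
    subst this
    exact ⟨rfl, h1.sendLeft_inj h1'⟩

end Messages

section LinearExtension

theorem transGen_insert {α : Type} {r : α → α → Prop} {a b x y : α}
    (h : TransGen (fun u v => r u v ∨ u = b ∧ v = a) x y) :
    TransGen r x y ∨ ReflTransGen r x b ∧ ReflTransGen r a y := by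
  induction h with
  | single h =>
    rcases h with h | ⟨rfl, rfl⟩
    · exact .inl (.single h)
    · exact .inr ⟨.refl, .refl⟩
  | tail _ h ih =>
    rcases h with h | ⟨rfl, rfl⟩
    · exact ih.imp (fun ih => ih.tail h) fun ih => ⟨ih.1, ih.2.tail h⟩
    · exact .inr ⟨ih.elim TransGen.to_reflTransGen And.left, .refl⟩

theorem exists_injective_strict {α : Type} [Finite α] {r : α → α → Prop}
    (hr : ∀ x, ¬ TransGen r x x) :
    ∃ f : α → ℕ, Function.Injective f ∧ ∀ x y, r x y → f x < f y := by
  classical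
  have := Fintype.ofFinite α
  have : IsPartialOrder α (ReflTransGen r) :=
    { refl := fun _ => .refl
      trans := fun _ _ _ => ReflTransGen.trans
      antisymm := by
        intro x y hxy hyx
        rcases reflTransGen_iff_eq_or_transGen.1 hxy with h | h
        · exact h.symm
        · exact absurd (h.trans_left hyx) (hr x) }
  obtain ⟨s, hs, hrs⟩ := extend_partialOrder (ReflTransGen r)
  have key : ∀ x y, s x y → x ≠ y →
      (Finset.univ.filter fun z => s z x).card < (Finset.univ.filter fun z => s z y).card := by
    intro x y hxy hne
    apply Finset.card_lt_card
    rw [Finset.ssubset_iff_of_subset]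
    · refine ⟨y, by simpa using refl_of s y, ?_⟩
      simpa using fun h => hne (antisymm_of s hxy h)
    · intro z
      simpa using fun h => trans_of s h hxy
  refine ⟨fun x => (Finset.univ.filter fun z => s z x).card, ?_, ?_⟩
  · intro x y hxy
    by_contra hne
    rcases total_of s x y with h | h
    · exact absurd hxy (key x y h hne).ne
    · exact absurd hxy (key y x h (Ne.symm hne)).ne'
  · intro x y hxy
    refine key x y (hrs _ _ (.single hxy)) ?_
    rintro rfl
    exact hr x (.single hxy)

theorem exists_injective_strict_le {α : Type} [Finite α] {r : α → α → Prop}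
    (hr : ∀ x, ¬ TransGen r x x) {a b : α} (hab : ¬ TransGen r a b) :
    ∃ f : α → ℕ, Function.Injective f ∧ (∀ x y, r x y → f x < f y) ∧ f b ≤ f a := by
  by_cases hne : a = b
  · obtain ⟨f, h1, h2⟩ := exists_injective_strict hr
    exact ⟨f, h1, h2, hne ▸ le_rfl⟩
  · obtain ⟨f, h1, h2⟩ := exists_injective_strict (r := fun u v => r u v ∨ u = b ∧ v = a) (by
      intro x hx
      rcases transGen_insert hx with h | ⟨h, h'⟩
      · exact hr x h
      · rcases reflTransGen_iff_eq_or_transGen.1 (h'.trans h) with h | h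
        · exact hne h.symm
        · exact hab h)
    exact ⟨f, h1, fun x y h => h2 x y (.inl h), (h2 b a (.inr ⟨rfl, rfl⟩)).le⟩

end LinearExtension

section Transfer

variable {D : DistAlg} {n : ℕ} {α : Type}

open Classical in
/-- The register contents after sending and receiving. -/
noncomputable def receive (t : Fin n → D.Δ) (c : Fin n → D.Reg → α) (j : Fin n) (r' : D.Reg) : α :=
  if h : ∃ p : Fin n × D.Reg, Sent t p.1 p.2 j r' then c h.choose.1 h.choose.2 else c j r'

/-- The register contents after an update. -/
def assign (t : Fin n → D.Δ) (c : Fin n → D.Reg → α) (j : Fin n) (r : D.Reg) : α :=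
  c j (((t j).1.update r).getD r)

theorem receive_of_sent {t : Fin n → D.Δ} (c : Fin n → D.Reg → α) {i j : Fin n} {r r' : D.Reg}
    (h : Sent t i r j r') : receive t c j r' = c i r := by
  have hex : ∃ p : Fin n × D.Reg, Sent t p.1 p.2 j r' := ⟨(i, r), h⟩
  obtain ⟨h1, h2⟩ := hex.choose_spec.unique h
  rw [receive, dif_pos hex, h1, h2]

theorem receive_of_not_sent {t : Fin n → D.Δ} (c : Fin n → D.Reg → α) {j : Fin n} {r' : D.Reg}
    (h : ∀ i r, ¬ Sent t i r j r') : receive t c j r' = c j r' :=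
  dif_neg fun ⟨_, hp⟩ => h _ _ hp

theorem Config.mid_eq_receive {R : PidRing} (C : Config D R) (t : Fin R.n → D.Δ) :
    C.mid t = receive t C.reg := by
  funext j r'
  by_cases h : ∃ p : Fin R.n × D.Reg, Sent t p.1 p.2 j r'
  · obtain ⟨p, hp⟩ := h
    have h : ∃ p : Fin R.n × D.Reg, SentRight t p.1 p.2 j r' ∨ SentLeft t p.1 p.2 j r' := ⟨p, hp⟩
    obtain ⟨h1, h2⟩ := Sent.unique h.choose_spec hp
    rw [receive_of_sent _ hp, Config.mid, dif_pos h, h1, h2]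
  · rw [receive_of_not_sent _ fun i r hs => h ⟨(i, r), hs⟩]
    exact dif_neg h

end Transfer

namespace Table

variable {D : DistAlg}

/-- The labels of the row `j`. -/
def row (T : Table D) (j : Fin (T.k + 1)) : Fin T.n → D.Δ := fun i => T.lab i j

/-- The process whose pid is stored in a register of a process before the round `j`. -/
noncomputable def origin (T : Table D) : ℕ → Fin T.n → D.Reg → Fin T.n
  | 0, i, _ => i
  | j + 1, i, r => assign (T.row (Fin.ofNat (T.k + 1) j))
      (receive (T.row (Fin.ofNat (T.k + 1) j)) (T.origin j)) i r

/-- The process whose pid is stored in a register of a process at a stage of the round `j`. -/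
noncomputable def source (T : Table D) (h : Fin 3) (j : Fin (T.k + 1)) :
    Fin T.n → D.Reg → Fin T.n :=
  match h with
  | 0 => T.origin j
  | 1 => receive (T.row j) (T.origin j)
  | 2 => T.origin (j + 1)

theorem source_two (T : Table D) (j : Fin (T.k + 1)) :
    T.source 2 j = assign (T.row j) (T.source 1 j) := by
  funext i r
  simp only [source, origin, Fin.ofNat_val_eq_self]

theorem source_zero_succ (T : Table D) {j j' : Fin (T.k + 1)} (h : (j : ℕ) + 1 = j') :
    T.source 0 j' = T.source 2 j := by
  simp only [source, h]

end Table

section Semantics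

variable {D : DistAlg} {T : Table D} {x y : Pos T.n T.k}

@[simp] theorem LForm.sat_false : LForm.false.Sat T x ↔ False := by
  simp [LForm.false, LForm.Sat]

@[simp] theorem LForm.sat_true : LForm.true.Sat T x ↔ True := by
  simp [LForm.true, LForm.Sat]

theorem LForm.sat_imp {ψ ψ' : LForm D} : (LForm.imp ψ ψ').Sat T x ↔ (ψ.Sat T x → ψ'.Sat T x) := by
  simp [LForm.imp, LForm.Sat]

theorem LForm.sat_box {π : LPath D} {ψ : LForm D} :
    (LForm.box π ψ).Sat T x ↔ ∀ y, π.Rel T x y → ψ.Sat T y := by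
  simp [LForm.box, LForm.Sat]

theorem LForm.sat_ex {π : LPath D} : (LForm.ex π).Sat T x ↔ ∃ y, π.Rel T x y := by
  simp [LForm.ex, LForm.Sat]

theorem LForm.sat_conjAll {α : Type} [Fintype α] {f : α → LForm D} :
    (LForm.conjAll f).Sat T x ↔ ∀ a, (f a).Sat T x := by
  have key : ∀ l : List (LForm D), (LForm.conj l).Sat T x ↔ ∀ ψ ∈ l, ψ.Sat T x := by
    intro l
    induction l with
    | nil => simp [LForm.conj]
    | cons ψ l ih => simp [LForm.conj, LForm.Sat, ih]
  simp [LForm.conjAll, key]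

theorem LPath.rel_sumAll {α : Type} [Fintype α] {f : α → LPath D} :
    (LPath.sumAll f).Rel T x y ↔ ∃ a, (f a).Rel T x y := by
  have key : ∀ l : List (LPath D), (LPath.sum l).Rel T x y ↔ ∃ π ∈ l, π.Rel T x y := by
    intro l
    induction l with
    | nil => simp [LPath.sum, LPath.Rel]
    | cons ψ l ih => simp [LPath.sum, LPath.Rel, ih]
  simp [LPath.sumAll, key]

theorem LPath.rel_plus {π : LPath D} : (LPath.plus π).Rel T x y ↔ TransGen (π.Rel T) x y := by
  simp only [LPath.plus, LPath.Rel]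
  exact TransGen.head'_iff.symm

theorem reflTransGen_same_row {n k : ℕ} {P : Fin (k + 1) → Fin n → Fin n → Prop} {x y : Pos n k} :
    ReflTransGen (fun u v : Pos n k => u.2 = v.2 ∧ P u.2 u.1 v.1) x y ↔
      x.2 = y.2 ∧ ReflTransGen (P x.2) x.1 y.1 := by
  constructor
  · intro h
    induction h with
    | refl => exact ⟨rfl, .refl⟩
    | tail _ h ih => exact ⟨ih.1.trans h.1, ih.2.tail (ih.1 ▸ h.2)⟩
  · obtain ⟨i, j⟩ := x
    obtain ⟨i', j'⟩ := y
    rintro ⟨rfl, h⟩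
    exact h.lift (fun i => (i, j)) fun a b hab => ⟨rfl, hab⟩

theorem LPath.rel_star_left : (LPath.star .left).Rel T x y ↔ y.1 ≤ x.1 ∧ x.2 = y.2 := by
  simp only [LPath.Rel, LPath.left]
  constructor
  · intro h
    induction h with
    | refl => exact ⟨le_rfl, rfl⟩
    | tail _ h ih => exact ⟨by simp only [Fin.le_def] at *; omega, ih.2.trans h.2.symm⟩
  · obtain ⟨⟨i, hi⟩, j⟩ := x
    obtain ⟨⟨i', hi'⟩, j'⟩ := y
    rintro ⟨h, rfl⟩
    simp only [Fin.mk_le_mk] at h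
    induction i, h using Nat.le_induction with
    | base => exact .refl
    | succ i h ih => exact .head (b := (⟨i, by omega⟩, j)) ⟨rfl, rfl⟩ (ih (by omega))

theorem LPath.rel_star_right : (LPath.star .right).Rel T x y ↔ x.1 ≤ y.1 ∧ x.2 = y.2 := by
  have := LPath.rel_star_left (T := T) (x := y) (y := x)
  simp only [LPath.Rel, LPath.left] at this ⊢
  rw [← reflTransGen_swap, eq_comm, ← this]

theorem LPath.rel_star_down : (LPath.star .down).Rel T x y ↔ x.1 = y.1 ∧ x.2 ≤ y.2 := by
  simp only [LPath.Rel]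
  constructor
  · intro h
    induction h with
    | refl => exact ⟨rfl, le_rfl⟩
    | tail _ h ih => exact ⟨ih.1.trans h.1, by simp only [Fin.le_def] at *; omega⟩
  · obtain ⟨i, ⟨j, hj⟩⟩ := x
    obtain ⟨i', ⟨j', hj'⟩⟩ := y
    rintro ⟨rfl, h⟩
    simp only [Fin.mk_le_mk] at h
    induction j', h using Nat.le_induction with
    | base => exact .refl
    | succ j' h ih => exact .tail (b := (i, ⟨j', by omega⟩)) (ih (by omega)) ⟨rfl, rfl⟩

theorem LForm.sat_ex_left : (LForm.ex .left).Sat T x ↔ (x.1 : ℕ) ≠ 0 := by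
  simp only [LForm.sat_ex, LPath.left, LPath.Rel]
  constructor
  · rintro ⟨y, h, _⟩; omega
  · intro h
    exact ⟨(⟨x.1 - 1, by omega⟩, x.2), by simp only; omega, rfl⟩

theorem LForm.sat_ex_right : (LForm.ex .right).Sat T x ↔ (x.1 : ℕ) + 1 ≠ T.n := by
  have hx := x.1.2
  simp only [LForm.sat_ex, LPath.Rel]
  constructor
  · rintro ⟨y, h, _⟩; omega
  · intro h
    exact ⟨(⟨x.1 + 1, by omega⟩, x.2), rfl, rfl⟩

theorem LForm.sat_ex_up : (LForm.ex .up).Sat T x ↔ x.2 ≠ 0 := by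
  simp only [LForm.sat_ex, LPath.up, LPath.Rel, ne_eq, Fin.ext_iff, Fin.val_zero]
  constructor
  · rintro ⟨y, _, h⟩; omega
  · intro h
    exact ⟨(x.1, ⟨x.2 - 1, by omega⟩), rfl, by simp only; omega⟩

theorem LPath.rel_cycRight :
    LPath.cycRight.Rel T x y ↔ IsRightNeighbor x.1 y.1 ∧ x.2 = y.2 := by
  have h : LPath.cycRight.Rel T x y ↔ ((x.1 : ℕ) + 1 = y.1 ∧ x.2 = y.2) ∨
      ¬ (LForm.ex .right).Sat T x ∧ (LPath.star .left).Rel T x y ∧ ¬ (LForm.ex .left).Sat T y := by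
    simp only [LPath.cycRight, LPath.Rel, LForm.Sat]
    constructor
    · rintro (h | ⟨_, ⟨rfl, h⟩, _, h', rfl, h''⟩)
      exacts [.inl h, .inr ⟨h, h', h''⟩]
    · rintro (h | ⟨h, h', h''⟩)
      exacts [.inl h, .inr ⟨_, ⟨rfl, h⟩, _, h', rfl, h''⟩]
  rw [h, LForm.sat_ex_right, LForm.sat_ex_left, LPath.rel_star_left, IsRightNeighbor, Fin.le_def]
  by_cases hr : x.2 = y.2
  · simp only [hr, and_true]; omega
  · simp [hr]

theorem LPath.rel_cycLeft :
    LPath.cycLeft.Rel T x y ↔ IsRightNeighbor y.1 x.1 ∧ x.2 = y.2 := by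
  rw [eq_comm, ← LPath.rel_cycRight]
  simp only [LPath.cycLeft, LPath.Rel]

/-- The path formulas of message transmissions, for an arbitrary neighborhood relation. -/
theorem rel_transmission {π : LPath D} {N : Fin T.n → Fin T.n → Prop}
    (hπ : ∀ u v, π.Rel T u v ↔ N u.1 v.1 ∧ u.2 = v.2) {γ γ' : Item D.S D.Reg} :
    (LPath.seq (.test (.item γ)) (.seq (.star (.seq π (.test (.item .fwd))))
      (.seq π (.test (.item γ'))))).Rel T x y ↔
    x.2 = y.2 ∧ (T.row x.2 x.1).1.Has γ ∧ (T.row x.2 y.1).1.Has γ' ∧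
      ∃ z, ReflTransGen (fun u v => N u v ∧ (T.row x.2 v).1.Has .fwd) x.1 z ∧ N z y.1 := by
  let P : Fin (T.k + 1) → Fin T.n → Fin T.n → Prop :=
    fun j i i' => N i i' ∧ (T.row j i').1.Has .fwd
  have hc : (fun u v : Pos T.n T.k => ∃ z, (N u.1 z.1 ∧ u.2 = z.2) ∧ z = v ∧
      (T.lab z.1 z.2).1.Has .fwd) = fun u v => u.2 = v.2 ∧ P u.2 u.1 v.1 := by
    funext u v
    apply propext
    constructor
    · rintro ⟨z, ⟨h1, h2⟩, rfl, h3⟩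
      exact ⟨h2, h1, by rw [h2]; exact h3⟩
    · rintro ⟨h1, h2, h3⟩
      exact ⟨v, ⟨h2, h1⟩, rfl, by rw [h1] at h3; exact h3⟩
  simp only [LPath.Rel, LForm.Sat, hπ]
  rw [hc]
  constructor
  · rintro ⟨_, ⟨rfl, h1⟩, z, h2, _, ⟨h4, h5⟩, rfl, h6⟩
    obtain ⟨h2, h3⟩ := (reflTransGen_same_row (P := P)).1 h2
    have := h2.trans h5
    exact ⟨this, h1, by rw [this]; exact h6, z.1, h3, h4⟩
  · obtain ⟨i, j⟩ := x
    obtain ⟨i', j'⟩ := y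
    rintro ⟨rfl, h1, h2, z, h3, h4⟩
    exact ⟨_, ⟨rfl, h1⟩, (z, j), (reflTransGen_same_row (P := P)).2 ⟨rfl, h3⟩, _, ⟨h4, rfl⟩, rfl, h2⟩

theorem rel_msgPath {r r' : D.Reg} :
    (msgPath r r').Rel T x y ↔ x.2 = y.2 ∧ Sent (T.row x.2) x.1 r y.1 r' := by
  rw [Sent, sentRight_iff_path, sentLeft_iff_path, and_or_left,
    ← rel_transmission (fun _ _ => LPath.rel_cycRight),
    ← rel_transmission (N := fun u v => IsRightNeighbor v u) (fun _ _ => LPath.rel_cycLeft),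
    msgPath, LPath.Rel]

theorem rel_locPath {r r' : D.Reg} :
    (locPath r r').Rel T x y ↔ r = r' ∧ x = y ∧ ∀ i q, ¬ Sent (T.row x.2) i q x.1 r := by
  rw [locPath]
  split_ifs with h
  · simp only [h, LPath.Rel, LForm.sat_conjAll, LForm.Sat, LForm.sat_ex, rel_msgPath, true_and]
    refine and_congr_right fun _ => ⟨?_, ?_⟩
    · intro h i q hs
      exact h q ⟨(i, x.2), rfl, hs⟩
    · rintro h q ⟨⟨i, j⟩, rfl, hs⟩
      exact h _ _ hs
  · simp [h, LPath.Rel]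

theorem rel_updPath {r r' : D.Reg} :
    (updPath r r').Rel T x y ↔ x = y ∧ ((T.lab x.1 x.2).1.update r').getD r' = r := by
  rw [updPath]
  split_ifs with h
  · subst h
    simp only [LPath.Rel, LForm.sat_conjAll, LForm.Sat, Transition.Has, Subtype.forall]
    refine and_congr_right fun _ => ?_
    cases h : (T.lab x.1 x.2).1.update r with
    | none => simp
    | some q =>
      simp only [Option.some.injEq, Option.getD_some]
      constructor
      · intro h; by_contra hne; exact h q hne rfl
      · rintro rfl a ha rfl; exact ha rfl
  · simp only [LPath.Rel, LForm.Sat, Transition.Has]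
    refine and_congr_right fun _ => ?_
    cases h' : (T.lab x.1 x.2).1.update r' with
    | none => simpa using fun h' => h h'.symm
    | some q => simp

theorem rel_nextPath {r r' : D.Reg} :
    (nextPath r r').Rel T x y ↔ r = r' ∧ x.1 = y.1 ∧ (x.2 : ℕ) + 1 = y.2 := by
  rw [nextPath]
  split_ifs with h <;> simp [h, LPath.Rel]

theorem source_eq_of_rel_path {θ : Theta} {q q' : D.Reg} (h : (θ.path q q').Rel T x y) :
    T.source θ.stage' y.2 y.1 q' = T.source θ.stage x.2 x.1 q := by
  cases θ with
  | loc =>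
    obtain ⟨rfl, rfl, h'⟩ := rel_locPath.1 h
    exact receive_of_not_sent _ h'
  | msg =>
    obtain ⟨h1, h'⟩ := rel_msgPath.1 h
    simp only [Theta.stage, Theta.stage']
    rw [← h1]
    exact receive_of_sent _ h'
  | upd =>
    obtain ⟨rfl, h'⟩ := rel_updPath.1 h
    simp only [Theta.stage, Theta.stage', T.source_two, assign]
    rw [← h']
    rfl
  | next =>
    obtain ⟨rfl, h1, h2⟩ := rel_nextPath.1 h
    simp only [Theta.stage, Theta.stage']
    rw [T.source_zero_succ h2, h1]

theorem IsAutPath.append {Q E : Type} {src tgt : E → Q} {q : Q} {w : List E} {e : E}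
    (h : IsAutPath src tgt q w (src e)) : IsAutPath src tgt q (w ++ [e]) (tgt e) := by
  induction w generalizing q with
  | nil => exact ⟨h.symm, rfl⟩
  | cons a w ih => exact ⟨h.1, ih h.2⟩

theorem compWord.append {E α : Type} {rel : E → α → α → Prop} {w : List E} {e : E} {x y z : α}
    (h : compWord rel w x y) (h' : rel e y z) : compWord rel (w ++ [e]) x z := by
  induction w generalizing x with
  | nil => obtain rfl : x = y := h; exact ⟨z, h', rfl⟩
  | cons a w ih => obtain ⟨u, hu, h⟩ := h; exact ⟨u, hu, ih h⟩

/-- The trace automata track the origin of the content of a register. -/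
theorem rel_traceAut {h : Fin 3} {r : D.Reg} :
    (traceAut h r).Rel T x y ↔ x.2 = 0 ∧ T.source h y.2 y.1 r = x.1 := by
  let src : D.Reg ⊕ (Theta × D.Reg × D.Reg) → Option (Fin 3 × D.Reg) :=
    Sum.elim (fun _ => none) (fun e => some (e.1.stage, e.2.1))
  let tgt : D.Reg ⊕ (Theta × D.Reg × D.Reg) → Option (Fin 3 × D.Reg) :=
    Sum.elim (fun q => some (0, q)) (fun e => some (e.1.stage', e.2.2))
  let label : D.Reg ⊕ (Theta × D.Reg × D.Reg) → LPath D :=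
    Sum.elim (fun _ => .test (.neg (.ex .up))) (fun e => e.1.path e.2.1 e.2.2)
  let Reach (h : Fin 3) (q : D.Reg) (y : Pos T.n T.k) : Prop :=
    ∃ w, IsAutPath src tgt none w (some (h, q)) ∧ compWord (fun e => (label e).Rel T) w x y
  have hrel : (traceAut h r).Rel T x y ↔ Reach h r y := by
    simp only [traceAut, LPath.Rel, Set.mem_singleton_iff]
    constructor
    · rintro ⟨w, q, rfl, h⟩
      exact ⟨w, h⟩
    · rintro ⟨w, h⟩
      exact ⟨w, _, rfl, h⟩
  have hstep : ∀ (θ : Theta) (q q' : D.Reg) (u v : Pos T.n T.k), Reach θ.stage q u →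
      (θ.path q q').Rel T u v → Reach θ.stage' q' v := by
    rintro θ q q' u v ⟨w, h1, h2⟩ h3
    exact ⟨w ++ [Sum.inr (θ, q, q')], IsAutPath.append (e := Sum.inr (θ, q, q')) h1,
      compWord.append (rel := fun e => (label e).Rel T) (e := Sum.inr (θ, q, q')) h2 h3⟩
  rw [hrel]
  constructor
  · rintro ⟨w, h1, h2⟩
    cases w with
    | nil => cases h1
    | cons a w =>
      obtain ⟨h1, h1'⟩ := h1
      obtain ⟨z, h2, h2'⟩ := h2
      rcases a with q | a
      · simp only [label, Sum.elim_inl, LPath.Rel, LForm.Sat, LForm.sat_ex_up, not_not] at h2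
        obtain ⟨rfl, hx⟩ := h2
        have inv : ∀ (w) (s : Fin 3 × D.Reg) (z : Pos T.n T.k), T.source s.1 z.2 z.1 s.2 = x.1 →
            IsAutPath src tgt (some s) w (some (h, r)) →
            compWord (fun e => (label e).Rel T) w z y → T.source h y.2 y.1 r = x.1 := by
          intro w
          induction w with
          | nil =>
            intro s z hz h1 h2
            cases h1
            obtain rfl : z = y := h2
            exact hz
          | cons a w ih =>
            rintro s z hz ⟨h1, h1'⟩ ⟨z', h2, h2'⟩
            rcases a with q | ⟨θ, q, q'⟩
            · cases h1
            · cases h1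
              exact ih _ _ ((source_eq_of_rel_path h2).trans hz) h1' h2'
        refine ⟨hx, inv w (0, q) x ?_ h1' h2'⟩
        simp only [hx]
        rfl
      · cases h1
  · rintro ⟨hx, hs⟩
    have s1 : ∀ j, (∀ (i : Fin T.n) q, T.source 0 j i q = x.1 → Reach 0 q (i, j)) →
        ∀ i q, T.source 1 j i q = x.1 → Reach 1 q (i, j) := by
      intro j h0 i q hq
      by_cases hsent : ∃ p : Fin T.n × D.Reg, Sent (T.row j) p.1 p.2 i q
      · obtain ⟨⟨i', q'⟩, hp⟩ := hsent
        have : T.source 1 j i q = T.source 0 j i' q' := receive_of_sent _ hp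
        exact hstep .msg q' q _ _ (h0 i' q' (this ▸ hq)) (rel_msgPath.2 ⟨rfl, hp⟩)
      · have hns : ∀ i' q', ¬ Sent (T.row j) i' q' i q := fun i' q' h => hsent ⟨(i', q'), h⟩
        have : T.source 1 j i q = T.source 0 j i q := receive_of_not_sent _ hns
        exact hstep .loc q q _ _ (h0 i q (this ▸ hq)) (rel_locPath.2 ⟨rfl, rfl, hns⟩)
    have s2 : ∀ j, (∀ (i : Fin T.n) q, T.source 1 j i q = x.1 → Reach 1 q (i, j)) →
        ∀ i q, T.source 2 j i q = x.1 → Reach 2 q (i, j) := by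
      intro j h1 i q hq
      rw [T.source_two] at hq
      exact hstep .upd _ q _ _ (h1 i _ hq) (rel_updPath.2 ⟨rfl, rfl⟩)
    have s0 : ∀ j, ∀ (i : Fin T.n) q, T.source 0 j i q = x.1 → Reach 0 q (i, j) := by
      intro j
      induction j using Fin.induction with
      | zero =>
        intro i q hq
        have hxi : x = (i, 0) := Prod.ext hq.symm hx
        refine ⟨[.inl q], ⟨rfl, rfl⟩, (i, 0), ⟨hxi, ?_⟩, rfl⟩
        simp [LForm.Sat, LForm.sat_ex_up, hx]
      | succ j ih =>
        intro i q hq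
        rw [T.source_zero_succ (j := j.castSucc) rfl] at hq
        exact hstep .next q q _ _ (s2 _ (s1 _ ih) i q hq) (rel_nextPath.2 ⟨rfl, rfl, rfl⟩)
    match h, hs with
    | 0, hs => exact s0 _ _ _ hs
    | 1, hs => exact s1 _ (s0 _) _ _ hs
    | 2, hs => exact s2 _ (s1 _ (s0 _)) _ _ hs

end Semantics

section SymbolicRuns

variable {D : DistAlg}

/-- A guard at a position of the table forces the pid of `i` to be smaller than the pid of `i'`. -/
def Table.ForcedLt (T : Table D) (i i' : Fin T.n) : Prop :=
  ∃ (x : Pos T.n T.k) (r r' : D.Reg), (T.lab x.1 x.2).1.Has (.lt r r') ∧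
    T.source 1 x.2 x.1 r = i ∧ T.source 1 x.2 x.1 r' = i'

theorem rel_piLt {T : Table D} {x y : Pos T.n T.k} :
    (piLt D).Rel T x y ↔ x.2 = 0 ∧ y.2 = 0 ∧ TransGen T.ForcedLt x.1 y.1 := by
  have hc : (LPath.sumAll fun p : D.Reg × D.Reg => LPath.seq (traceAut 1 p.1)
      (.seq (.test (.item (.lt p.1 p.2))) (.conv (traceAut 1 p.2)))).Rel T =
      fun u v => u.2 = 0 ∧ v.2 = 0 ∧ T.ForcedLt u.1 v.1 := by
    funext u v
    simp only [LPath.rel_sumAll, LPath.Rel, LForm.Sat, rel_traceAut]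
    apply propext
    constructor
    · rintro ⟨⟨r, r'⟩, z, ⟨h1, h2⟩, _, ⟨rfl, h3⟩, h4, h5⟩
      exact ⟨h1, h4, z, r, r', h3, h2, h5⟩
    · rintro ⟨h1, h2, z, r, r', h3, h4, h5⟩
      exact ⟨(r, r'), z, ⟨h1, h4⟩, z, ⟨rfl, h3⟩, h2, h5⟩
  rw [piLt, LPath.rel_plus, hc]
  constructor
  · intro h
    induction h with
    | single h => exact ⟨h.1, h.2.1, .single h.2.2⟩
    | tail _ h ih => exact ⟨ih.1, h.2.1, ih.2.2.tail h.2.2⟩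
  · obtain ⟨i, j⟩ := x
    obtain ⟨i', j'⟩ := y
    rintro ⟨rfl, rfl, h⟩
    exact h.lift (fun i => (i, (0 : Fin (T.k + 1)))) fun a b hab => ⟨rfl, rfl, hab⟩

/-- The table is a symbolic run: some assignment of pids turns it into a run. -/
structure Table.Consistent (T : Table D) (t : D.Δ) : Prop where
  eq : ∀ (i : Fin T.n) (j : Fin (T.k + 1)) (r r' : D.Reg), (T.lab i j).1.Has (.eq r r') →
    T.source 1 j i r = T.source 1 j i r'
  lt : ∀ i, ¬ TransGen T.ForcedLt i i
  zero : ∀ i, T.lab i 0 = t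
  next : ∀ (i : Fin T.n) (j : Fin T.k), (T.lab i j.succ).1.src = (T.lab i j.castSucc).1.tgt

theorem rel_star_right_down {T : Table D} {x y : Pos T.n T.k} (h1 : x.1 ≤ y.1) (h2 : x.2 ≤ y.2) :
    (LPath.star (.alt .right .down)).Rel T x y := by
  have hr : (LPath.star .right).Rel T x (y.1, x.2) := LPath.rel_star_right.2 ⟨h1, rfl⟩
  have hd : (LPath.star .down).Rel T (y.1, x.2) y := LPath.rel_star_down.2 ⟨rfl, h2⟩
  simp only [LPath.Rel] at hr hd ⊢
  refine ReflTransGen.trans (b := (y.1, x.2)) (ReflTransGen.mono ?_ _ _ hr)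
    (ReflTransGen.mono ?_ _ _ hd)
  · exact fun _ _ h => Or.inl h
  · exact fun _ _ h => Or.inr h

theorem sat_psiEq {T : Table D} :
    (psiEq D).Sat T (⟨0, T.n_pos⟩, 0) ↔ ∀ (i : Fin T.n) (j : Fin (T.k + 1)) (r r' : D.Reg),
      (T.lab i j).1.Has (.eq r r') → T.source 1 j i r = T.source 1 j i r' := by
  have hloop : ∀ (y : Pos T.n T.k) (r r' : D.Reg),
      (LForm.loop (.seq (.conv (traceAut 1 r)) (traceAut 1 r'))).Sat T y ↔
        T.source 1 y.2 y.1 r = T.source 1 y.2 y.1 r' := by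
    intro y r r'
    simp only [LForm.Sat, LPath.Rel, rel_traceAut]
    constructor
    · rintro ⟨z, ⟨_, h1⟩, _, h2⟩
      exact h1.trans h2.symm
    · intro h
      exact ⟨(T.source 1 y.2 y.1 r, 0), ⟨rfl, rfl⟩, rfl, h.symm⟩
  simp only [psiEq, LForm.sat_box, LForm.sat_conjAll, LForm.sat_imp, hloop, Prod.forall]
  constructor
  · intro h i j r r' hr
    exact h i j (rel_star_right_down (Fin.mk_le_of_le_val (Nat.zero_le _)) (Fin.zero_le _)) r r' hr
  · intro h i j _ r r' hr
    exact h i j r r' hr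

theorem sat_psiLt {T : Table D} :
    (psiLt D).Sat T (⟨0, T.n_pos⟩, 0) ↔ ∀ i, ¬ TransGen T.ForcedLt i i := by
  have : (psiLt D).Sat T (⟨0, T.n_pos⟩, 0) ↔ ∀ y, (LPath.star .right).Rel T (⟨0, T.n_pos⟩, 0) y →
      ¬ (piLt D).Rel T y y := by
    simp only [psiLt, LForm.Sat, not_exists, not_and]
  simp only [this, LPath.rel_star_right, rel_piLt]
  constructor
  · intro h i hi
    exact h (i, 0) ⟨Fin.mk_le_of_le_val (Nat.zero_le _), rfl⟩ ⟨rfl, rfl, hi⟩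
  · intro h y _ hy
    exact h _ hy.2.2

theorem sat_psiCol {T : Table D} {t : D.Δ} :
    (psiCol D t).Sat T (⟨0, T.n_pos⟩, 0) ↔ (∀ i, T.lab i 0 = t) ∧
      ∀ (i : Fin T.n) (j : Fin T.k), (T.lab i j.succ).1.src = (T.lab i j.castSucc).1.tgt := by
  simp only [psiCol, LForm.sat_box, LForm.sat_conjAll, LForm.sat_imp, LPath.rel_star_right,
    LPath.rel_star_down, LForm.Sat, Transition.Has]
  constructor
  · intro h
    have h' := fun i : Fin T.n => h (i, 0) ⟨Fin.mk_le_of_le_val (Nat.zero_le _), rfl⟩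
    refine ⟨fun i => (h' i).1, fun i j => ?_⟩
    exact (h' i).2 (i, j.castSucc) ⟨rfl, Fin.zero_le _⟩ _ rfl (i, j.succ) ⟨rfl, rfl⟩
  · rintro ⟨h0, h⟩ ⟨i, j⟩ ⟨_, hj⟩
    obtain rfl : 0 = j := hj
    refine ⟨h0 i, ?_⟩
    rintro ⟨i', j'⟩ _ s rfl ⟨i'', j''⟩ ⟨h1, h2⟩
    obtain rfl : i' = i'' := h1
    simp only at h2
    have e1 : j' = Fin.castSucc ⟨j', by omega⟩ := rfl
    have e2 : j'' = Fin.succ ⟨j', by omega⟩ := Fin.ext h2.symm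
    simp only
    rw [e2, h]
    rfl

theorem sat_psiAlg {T : Table D} {t : D.Δ} :
    (psiAlg D t).Sat T (⟨0, T.n_pos⟩, 0) ↔ T.Consistent t := by
  have : (psiAlg D t).Sat T (⟨0, T.n_pos⟩, 0) ↔ (psiEq D).Sat T (⟨0, T.n_pos⟩, 0) ∧
      (psiLt D).Sat T (⟨0, T.n_pos⟩, 0) ∧ (psiCol D t).Sat T (⟨0, T.n_pos⟩, 0) := by
    simp only [psiAlg, LForm.Sat]
  rw [this, sat_psiEq, sat_psiLt, sat_psiCol]
  exact ⟨fun ⟨h1, h2, h3, h4⟩ => ⟨h1, h2, h3, h4⟩, fun ⟨h1, h2, h3, h4⟩ => ⟨h1, h2, h3, h4⟩⟩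

/-- The comparison of the pids of `i` and `i'` is forced by the table. -/
def Cmp.Forced (T : Table D) : Cmp → Fin T.n → Fin T.n → Prop
  | .eq, i, i' => i = i'
  | .ne, i, i' => i ≠ i'
  | .lt, i, i' => TransGen T.ForcedLt i i'
  | .le, i, i' => TransGen T.ForcedLt i i' ∨ i = i'

theorem rel_trace_seq {T : Table D} {κ : LPath D} {r r' : D.Reg} {x y : Pos T.n T.k} :
    (LPath.seq (.conv (traceAut 2 r)) (.seq κ (traceAut 2 r'))).Rel T x y ↔
      κ.Rel T (T.source 2 x.2 x.1 r, 0) (T.source 2 y.2 y.1 r', 0) := by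
  simp only [LPath.Rel, rel_traceAut]
  constructor
  · rintro ⟨⟨i, j⟩, ⟨h1, h2⟩, ⟨i', j'⟩, h3, h4, h5⟩
    simp only at h1 h2 h4 h5
    subst h1 h2 h4 h5
    exact h3
  · intro h
    exact ⟨_, ⟨rfl, rfl⟩, _, h, rfl, rfl⟩

theorem rel_evidence {T : Table D} {c : Cmp} {r r' : D.Reg} {x y : Pos T.n T.k} :
    (c.evidence r r').Rel T x y ↔
      c.Forced T (T.source 2 x.2 x.1 r) (T.source 2 y.2 y.1 r') := by
  cases c with
  | eq =>
    have : (Cmp.eq.evidence r r' : LPath D).Rel T x y ↔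
        (LPath.seq (.conv (traceAut 2 r)) (.seq .stay (traceAut 2 r'))).Rel T x y := by
      simp [Cmp.evidence, LPath.Rel]
    rw [this, rel_trace_seq]
    simp [LPath.Rel, Cmp.Forced]
  | ne =>
    rw [Cmp.evidence, rel_trace_seq, Cmp.Forced]
    generalize T.source 2 x.2 x.1 r = i
    generalize T.source 2 y.2 y.1 r' = i'
    have hl : (LPath.plus .left).Rel T (i, 0) (i', 0) ↔ i' < i := by
      have : (LPath.plus .left).Rel T (i, 0) (i', 0) ↔
          ∃ z, LPath.right.Rel T z (i, 0) ∧ (LPath.star .left).Rel T z (i', 0) := by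
        simp only [LPath.plus, LPath.left, LPath.Rel]
      rw [this, Fin.lt_def]
      constructor
      · rintro ⟨z, h1, h2⟩
        have h2 := (LPath.rel_star_left.1 h2).1
        simp only [LPath.Rel, Fin.le_def] at h1 h2
        omega
      · intro h
        refine ⟨(⟨i - 1, by omega⟩, 0), ?_, LPath.rel_star_left.2 ⟨?_, rfl⟩⟩
        · simp only [LPath.Rel, and_true]; omega
        · simp only [Fin.le_def]; omega
    have hr : (LPath.plus .right).Rel T (i, 0) (i', 0) ↔ i < i' := by
      have : (LPath.plus .right).Rel T (i, 0) (i', 0) ↔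
          ∃ z, LPath.right.Rel T (i, 0) z ∧ (LPath.star .right).Rel T z (i', 0) := by
        simp only [LPath.plus, LPath.Rel]
      rw [this, Fin.lt_def]
      constructor
      · rintro ⟨z, h1, h2⟩
        have h2 := (LPath.rel_star_right.1 h2).1
        simp only [LPath.Rel, Fin.le_def] at h1 h2
        omega
      · intro h
        refine ⟨(⟨i + 1, by omega⟩, 0), ?_, LPath.rel_star_right.2 ⟨?_, rfl⟩⟩
        · simp only [LPath.Rel, and_true]
        · simp only [Fin.le_def]; omega
    rw [LPath.Rel, hl, hr, or_comm, ne_iff_lt_or_gt]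
  | lt =>
    rw [Cmp.evidence, rel_trace_seq, rel_piLt]
    simp [Cmp.Forced]
  | le =>
    rw [Cmp.evidence, rel_trace_seq, LPath.Rel, rel_piLt]
    simp [Cmp.Forced, LPath.Rel]

end SymbolicRuns

theorem Table.source_two_zero {D : DistAlg} {t : D.Δ} {T : Table D} (ht : D.IsDummy t) (h : ∀ i, T.lab i 0 = t)
    (i : Fin T.n) (r : D.Reg) : T.source 2 0 i r = i := by
  have hrow : T.row 0 = fun _ => t := funext h
  have hs : ∀ i' r' i r, ¬ Sent (fun _ : Fin T.n => t) i' r' i r := by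
    rintro i' r' i r (⟨h, _⟩ | ⟨h, _⟩) <;> simp [Transition.Has, ht.send] at h
  have h1 : T.source 1 0 = receive (T.row 0) (T.origin 0) := rfl
  rw [T.source_two, assign, h1, hrow, receive_of_not_sent _ fun _ _ => hs _ _ _ _]
  rfl

section Representation

variable {D : DistAlg} {R : PidRing} {t : D.Δ}

/-- A table of the dimensions of a run. -/
abbrev Run.table (χ : Run D R) (lab : Fin R.n → Fin (χ.k + 1) → D.Δ) : Table D :=
  ⟨R.n, χ.k, R.pos, χ.pos, lab⟩

/-- The table is obtained from the run by the rotation `e` that moves `m` to the first column, and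
by adding a row of dummy transitions. -/
structure Represents (t : D.Δ) (χ : Run D R) (m : Fin R.n) (e : Equiv.Perm (Fin R.n))
    (lab : Fin R.n → Fin (χ.k + 1) → D.Δ) : Prop where
  mark : (e m : ℕ) = 0
  neighbor : ∀ i i', IsRightNeighbor (e i) (e i') ↔ IsRightNeighbor i i'
  zero : ∀ i, lab i 0 = t
  succ : ∀ i j, lab (e i) j.succ = χ.trans j i

variable {χ : Run D R} {m : Fin R.n} {e : Equiv.Perm (Fin R.n)}
  {lab : Fin R.n → Fin (χ.k + 1) → D.Δ}

theorem Represents.sent_iff (h : Represents t χ m e lab) {j : Fin χ.k} {i i' : Fin R.n}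
    {r r' : D.Reg} :
    Sent ((χ.table lab).row j.succ) (e i) r (e i') r' ↔ Sent (χ.trans j) i r i' r' := by
  constructor
  · intro hs
    have := hs.map (t' := χ.trans j) (e := e.symm)
      (fun a b hab => by rw [← h.neighbor]; simpa using hab)
      (fun a => by
        rw [← h.succ, e.apply_symm_apply]
        rfl)
    simpa using this
  · intro hs
    exact hs.map (fun a b hab => (h.neighbor a b).2 hab) fun a => h.succ a j

theorem Represents.mid_of_reg (h : Represents t χ m e lab) {j : Fin χ.k}
    (hj : ∀ i r, ((χ.conf j.castSucc).reg i r : ℕ) =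
      R.pid (e.symm ((χ.table lab).source 2 j.castSucc (e i) r))) (i : Fin R.n) (r : D.Reg) :
    ((χ.conf j.castSucc).mid (χ.trans j) i r : ℕ) =
      R.pid (e.symm ((χ.table lab).source 1 j.succ (e i) r)) := by
  have h0 : (χ.table lab).source 0 j.succ = (χ.table lab).source 2 j.castSucc :=
    (χ.table lab).source_zero_succ rfl
  have h1 : (χ.table lab).source 1 j.succ = receive ((χ.table lab).row j.succ)
    ((χ.table lab).source 0 j.succ) := rfl
  rw [Config.mid_eq_receive, h1, h0]
  by_cases hs : ∃ p : Fin R.n × D.Reg, Sent (χ.trans j) p.1 p.2 i r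
  · obtain ⟨p, hp⟩ := hs
    rw [receive_of_sent _ hp, receive_of_sent _ (h.sent_iff.2 hp), hj]
  · have hs' : ∀ i' r', ¬ Sent (χ.trans j) i' r' i r := fun i' r' hp => hs ⟨(i', r'), hp⟩
    rw [receive_of_not_sent _ hs', receive_of_not_sent, hj]
    intro i' r' hp
    obtain ⟨i', rfl⟩ := e.surjective i'
    exact hs' _ _ (h.sent_iff.1 hp)

theorem Represents.reg (h : Represents t χ m e lab) (ht : D.IsDummy t) (j : Fin (χ.k + 1))
    (i : Fin R.n) (r : D.Reg) :
    ((χ.conf j).reg i r : ℕ) = R.pid (e.symm ((χ.table lab).source 2 j (e i) r)) := by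
  induction j using Fin.induction generalizing i r with
  | zero =>
    rw [(χ.initial i).2, (χ.table lab).source_two_zero ht h.zero, e.symm_apply_apply]
  | succ j ih =>
    have hm := h.mid_of_reg ih
    have hrow : (χ.table lab).row j.succ (e i) = χ.trans j i := h.succ i j
    rw [(χ.table lab).source_two, assign, hrow, ← hm]
    cases hu : (χ.trans j i).1.update r with
    | none => rw [(χ.step j).keep i r (by simp [Transition.Has, hu]), Option.getD_none]
    | some q => rw [(χ.step j).upd i r q hu, Option.getD_some]

theorem Represents.mid (h : Represents t χ m e lab) (ht : D.IsDummy t) (j : Fin χ.k)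
    (i : Fin R.n) (r : D.Reg) :
    ((χ.conf j.castSucc).mid (χ.trans j) i r : ℕ) =
      R.pid (e.symm ((χ.table lab).source 1 j.succ (e i) r)) :=
  h.mid_of_reg (h.reg ht _) i r

theorem Represents.tgt (h : Represents t χ m e lab) (ht : D.IsDummy t) (j : Fin (χ.k + 1))
    (i : Fin R.n) : (lab (e i) j).1.tgt = (χ.conf j).state i := by
  cases j using Fin.cases with
  | zero => rw [h.zero, ht.tgt, (χ.initial i).1]
  | succ j => rw [h.succ]; exact (χ.step j).tgt i

theorem Represents.pid_lt (h : Represents t χ m e lab) (ht : D.IsDummy t) {i i' : Fin R.n}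
    (hi : TransGen (χ.table lab).ForcedLt i i') : R.pid (e.symm i) < R.pid (e.symm i') := by
  have key : ∀ i i', (χ.table lab).ForcedLt i i' → R.pid (e.symm i) < R.pid (e.symm i') := by
    rintro _ _ ⟨⟨i, j⟩, r, r', hr, rfl, rfl⟩
    obtain ⟨i, rfl⟩ := e.surjective i
    cases j using Fin.cases with
    | zero =>
      have : lab (e i) 0 = t := h.zero _
      simp [Transition.Has, this, ht.guards] at hr
    | succ j =>
      have hlab : lab (e i) j.succ = χ.trans j i := h.succ i j
      rw [← h.mid ht, ← h.mid ht]
      exact (χ.step j).lt i r r' (hlab ▸ hr)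
  induction hi with
  | single hi => exact key _ _ hi
  | tail _ hi ih => exact ih.trans (key _ _ hi)

theorem Represents.consistent (h : Represents t χ m e lab) (ht : D.IsDummy t) :
    (χ.table lab).Consistent t where
  eq i j r r' hr := by
    obtain ⟨i, rfl⟩ := e.surjective i
    cases j using Fin.cases with
    | zero =>
      have : lab (e i) 0 = t := h.zero _
      simp [Transition.Has, this, ht.guards] at hr
    | succ j =>
      have hlab : lab (e i) j.succ = χ.trans j i := h.succ i j
      have := (χ.step j).eq i r r' (hlab ▸ hr)
      rw [Subtype.ext_iff, h.mid ht, h.mid ht] at this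
      exact e.symm.injective (R.inj this)
  lt i hi := lt_irrefl _ (h.pid_lt ht hi)
  zero := h.zero
  next i j := by
    obtain ⟨i, rfl⟩ := e.surjective i
    have h1 : lab (e i) j.succ = χ.trans j i := h.succ i j
    have h2 := h.tgt ht j.castSucc i
    change (lab (e i) j.succ).1.src = (lab (e i) j.castSucc).1.tgt
    rw [h1, h2]
    exact (χ.step j).src i

/-- Every run with a marked process is represented by some table. -/
theorem Run.exists_represents (t : D.Δ) (χ : Run D R) (m : Fin R.n) :
    ∃ e lab, Represents t χ m e lab := by
  have : NeZero R.n := ⟨by have := R.pos; omega⟩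
  refine ⟨Equiv.subRight m,
    fun i j => Fin.cases t (fun j => χ.trans j ((Equiv.subRight m).symm i)) j, ?_, ?_, ?_, ?_⟩
  · simp
  · intro i i'
    simp only [isRightNeighbor_iff_add_one, Equiv.subRight_apply]
    rw [sub_eq_iff_eq_add, add_right_comm, sub_add_cancel]
  · intro i; rfl
  · intro i j
    simp

theorem Cmp.holds_of_forced (h : Represents t χ m e lab)
    (ht : D.IsDummy t) {c : Cmp} {r r' : D.Reg} {x y : Pos R.n χ.k}
    (hc : c.Forced (χ.table lab) ((χ.table lab).source 2 x.2 (e x.1) r)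
      ((χ.table lab).source 2 y.2 (e y.1) r')) :
    c.Holds ((χ.conf x.2).reg x.1 r) ((χ.conf y.2).reg y.1 r') := by
  cases c with
  | eq =>
    rw [Cmp.Holds, Subtype.ext_iff, h.reg ht, h.reg ht]
    rw [Cmp.Forced] at hc
    rw [hc]
  | ne =>
    rw [Cmp.Holds, Ne, Subtype.ext_iff, h.reg ht, h.reg ht]
    exact fun he => hc (e.symm.injective (R.inj he))
  | lt =>
    rw [Cmp.Holds, ← Subtype.coe_lt_coe, h.reg ht, h.reg ht]
    exact h.pid_lt ht hc
  | le =>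
    rw [Cmp.Holds, ← Subtype.coe_le_coe, h.reg ht, h.reg ht]
    rcases hc with hc | hc
    · exact (h.pid_lt ht hc).le
    · rw [hc]

theorem Cmp.holds_iff_forced (h : Represents t χ m e lab)
    (ht : D.IsDummy t) {c : Cmp} (ho : ¬ c.IsOrder) {r r' : D.Reg} {x y : Pos R.n χ.k} :
    c.Forced (χ.table lab) ((χ.table lab).source 2 x.2 (e x.1) r)
      ((χ.table lab).source 2 y.2 (e y.1) r') ↔
    c.Holds ((χ.conf x.2).reg x.1 r) ((χ.conf y.2).reg y.1 r') := by
  refine ⟨Cmp.holds_of_forced h ht, fun hc => ?_⟩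
  cases c with
  | eq =>
    rw [Cmp.Holds, Subtype.ext_iff, h.reg ht, h.reg ht] at hc
    exact e.symm.injective (R.inj hc)
  | ne =>
    rw [Cmp.Holds, Ne, Subtype.ext_iff, h.reg ht, h.reg ht] at hc
    exact fun he => hc (by rw [he])
  | lt => exact absurd trivial ho
  | le => exact absurd trivial ho

end Representation

section Translation

variable {D : DistAlg} {R : PidRing} {t : D.Δ} {χ : Run D R} {m : Fin R.n}
  {e : Equiv.Perm (Fin R.n)} {lab : Fin R.n → Fin (χ.k + 1) → D.Δ}

/-- The rotation of the positions of a run. -/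
def rotate (χ : Run D R) (e : Equiv.Perm (Fin R.n)) : Equiv.Perm (Pos R.n χ.k) :=
  e.prodCongr (.refl _)

theorem reflTransGen_equiv {α β : Type} (E : α ≃ β) {P : α → α → Prop} {Q : β → β → Prop}
    (h : ∀ a b, Q (E a) (E b) ↔ P a b) {a b : α} :
    ReflTransGen Q (E a) (E b) ↔ ReflTransGen P a b := by
  constructor
  · intro hq
    have : ReflTransGen P (E.symm (E a)) (E.symm (E b)) :=
      hq.lift E.symm fun u v huv => (h _ _).1 (by simpa using huv)
    simpa using this
  · exact fun hp => hp.lift E fun u v => (h u v).2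

mutual

theorem DForm.sat_transl_iff (h : Represents t χ m e lab) (ht : D.IsDummy t) :
    ∀ (φ : DForm D.S D.Reg), φ.NoOrder → ∀ x : Pos R.n χ.k,
      (φ.transl.Sat (χ.table lab) (rotate χ e x) ↔ φ.Sat χ m x)
  | .mark, _, x => by
    have := LForm.sat_ex_left (T := χ.table lab) (x := rotate χ e x)
    simp only [DForm.transl, LForm.Sat, DForm.Sat, this, not_not]
    change (e x.1 : ℕ) = 0 ↔ _
    rw [← h.mark, ← Fin.ext_iff, e.injective.eq_iff]
  | .state s, _, x => by
    simp only [DForm.transl, LForm.Sat, DForm.Sat, Transition.Has]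
    rw [← h.tgt ht]
    rfl
  | .neg φ, hφ, x => by
    simp only [DForm.transl, LForm.Sat, DForm.Sat]
    exact not_congr (φ.sat_transl_iff h ht hφ x)
  | .and φ φ', hφ, x => by
    simp only [DForm.transl, LForm.Sat, DForm.Sat]
    exact and_congr (φ.sat_transl_iff h ht hφ.1 x) (φ'.sat_transl_iff h ht hφ.2 x)
  | .imp φ φ', hφ, x => by
    simp only [DForm.transl, LForm.sat_imp, DForm.Sat]
    exact imp_congr (φ.sat_transl_iff h ht hφ.1 x) (φ'.sat_transl_iff h ht hφ.2 x)
  | .box π φ, hφ, x => by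
    simp only [DForm.transl, LForm.sat_box, DForm.Sat]
    rw [← (rotate χ e).forall_congr_right]
    exact forall_congr' fun y =>
      imp_congr (π.rel_transl_iff h ht hφ.1 x y) (φ.sat_transl_iff h ht hφ.2 y)
  | .cmp c r r' π π', hφ, x => by
    simp only [DForm.transl, LForm.Sat, LPath.Rel, DForm.Sat]
    rw [← (rotate χ e).exists_congr_right]
    refine exists_congr fun y => ?_
    simp only [← exists_and_left]
    rw [← (rotate χ e).exists_congr_right]
    refine exists_congr fun y' => ?_
    rw [π.rel_transl_iff h ht hφ.2.1 x y, π'.rel_transl_iff h ht hφ.2.2 x y', rel_evidence,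
      and_comm (a := Cmp.Forced _ _ _ _)]
    exact and_congr_right fun _ => and_congr_right fun _ =>
      Cmp.holds_iff_forced h ht hφ.1 (x := y) (y := y')

theorem DPath.rel_transl_iff (h : Represents t χ m e lab) (ht : D.IsDummy t) :
    ∀ (π : DPath D.S D.Reg), π.NoOrder → ∀ x y : Pos R.n χ.k,
      (π.transl.Rel (χ.table lab) (rotate χ e x) (rotate χ e y) ↔ π.Rel χ m x y)
  | .test φ, hφ, x, y => by
    simp only [DPath.transl, LPath.Rel, DPath.Rel]
    exact and_congr (rotate χ e).injective.eq_iff (φ.sat_transl_iff h ht hφ x)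
  | .stay, _, x, y => by
    simp only [DPath.transl, LPath.Rel, DPath.Rel]
    exact (rotate χ e).injective.eq_iff
  | .left, _, x, y => by
    rw [DPath.transl, LPath.rel_cycLeft, DPath.Rel]
    exact and_congr (h.neighbor _ _) Iff.rfl
  | .right, _, x, y => by
    rw [DPath.transl, LPath.rel_cycRight, DPath.Rel]
    exact and_congr (h.neighbor _ _) Iff.rfl
  | .up, _, x, y => by
    simp only [DPath.transl, LPath.up, LPath.Rel, DPath.Rel]
    exact and_congr (e.injective.eq_iff.trans eq_comm) Iff.rfl
  | .down, _, x, y => by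
    simp only [DPath.transl, LPath.Rel, DPath.Rel]
    exact and_congr e.injective.eq_iff Iff.rfl
  | .alt π π', hφ, x, y => by
    simp only [DPath.transl, LPath.Rel, DPath.Rel]
    exact or_congr (π.rel_transl_iff h ht hφ.1 x y) (π'.rel_transl_iff h ht hφ.2 x y)
  | .seq π π', hφ, x, y => by
    simp only [DPath.transl, LPath.Rel, DPath.Rel]
    rw [← (rotate χ e).exists_congr_right]
    exact exists_congr fun z =>
      and_congr (π.rel_transl_iff h ht hφ.1 x z) (π'.rel_transl_iff h ht hφ.2 z y)
  | .star π, hφ, x, y => by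
    simp only [DPath.transl, LPath.Rel, DPath.Rel]
    exact reflTransGen_equiv _ fun a b => π.rel_transl_iff h ht hφ a b

end

/-- A restricted formula holds in every run represented by a table that satisfies its
translation. -/
theorem DForm.sat_of_sat_transl (h : Represents t χ m e lab) (ht : D.IsDummy t) :
    ∀ (φ : DForm D.S D.Reg), φ.Restricted D → ∀ x : Pos R.n χ.k,
      φ.transl.Sat (χ.table lab) (rotate χ e x) → φ.Sat χ m x
  | .mark, _, x => (DForm.sat_transl_iff h ht .mark trivial x).1
  | .state s, _, x => (DForm.sat_transl_iff h ht (.state s) trivial x).1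
  | .neg φ, hφ, x => (DForm.sat_transl_iff h ht (.neg φ) hφ x).1
  | .and φ φ', hφ, x => by
    simp only [DForm.transl, LForm.Sat, DForm.Sat]
    exact And.imp (φ.sat_of_sat_transl h ht hφ.1 x) (φ'.sat_of_sat_transl h ht hφ.2 x)
  | .imp φ φ', hφ, x => by
    simp only [DForm.transl, LForm.sat_imp, DForm.Sat]
    exact fun hi hx => φ'.sat_of_sat_transl h ht hφ.2 x (hi ((φ.sat_transl_iff h ht hφ.1 x).2 hx))
  | .box π φ, hφ, x => by
    simp only [DForm.transl, LForm.sat_box, DForm.Sat]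
    exact fun hb y hy => φ.sat_of_sat_transl h ht hφ.2 y
      (hb _ ((π.rel_transl_iff h ht hφ.1 x y).2 hy))
  | .cmp c r r' π π', hφ, x => by
    simp only [DForm.transl, LForm.Sat, LPath.Rel, DForm.Sat]
    rintro ⟨z, h1, z', h2, h3⟩
    obtain ⟨y, rfl⟩ := (rotate χ e).surjective z
    obtain ⟨y', rfl⟩ := (rotate χ e).surjective z'
    exact ⟨y, y', (π.rel_transl_iff h ht hφ.1 x y).1 h1, (π'.rel_transl_iff h ht hφ.2.1 x y').1 h3,
      Cmp.holds_of_forced h ht (rel_evidence.1 h2)⟩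

end Translation

section Realization

variable {D : DistAlg} {t : D.Δ}

/-- The ring with the width of a table and given pids. -/
abbrev Table.ring (T : Table D) (pid : Fin T.n → ℕ) (hinj : Function.Injective pid) : PidRing :=
  ⟨T.n, T.n_pos, pid, hinj⟩

/-- The configuration after the round `j` of a symbolic run, for given pids. -/
noncomputable def Table.conf (T : Table D) (pid : Fin T.n → ℕ) (hinj : Function.Injective pid)
    (j : Fin (T.k + 1)) : Config D (T.ring pid hinj) where
  state i := (T.lab i j).1.tgt
  reg i r := ⟨pid (T.source 2 j i r), Set.mem_range_self _⟩

theorem Table.mid_conf (T : Table D) (pid : Fin T.n → ℕ) (hinj : Function.Injective pid)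
    (j : Fin T.k) (i : Fin T.n) (r : D.Reg) :
    ((T.conf pid hinj j.castSucc).mid (T.row j.succ) i r : ℕ) = pid (T.source 1 j.succ i r) := by
  have h1 : T.source 1 j.succ = receive (T.row j.succ) (T.source 0 j.succ) := rfl
  rw [Config.mid_eq_receive, h1, T.source_zero_succ (j := j.castSucc) rfl]
  by_cases hs : ∃ p : Fin T.n × D.Reg, Sent (T.row j.succ) p.1 p.2 i r
  · obtain ⟨p, hp⟩ := hs
    rw [receive_of_sent _ hp, receive_of_sent _ hp]
    rfl
  · have hs' : ∀ i' r', ¬ Sent (T.row j.succ) i' r' i r := fun i' r' hp => hs ⟨(i', r'), hp⟩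
    rw [receive_of_not_sent _ hs', receive_of_not_sent _ hs']
    rfl

/-- The run that is obtained from a symbolic run by choosing pids. -/
noncomputable def Table.Consistent.run {T : Table D} (hT : T.Consistent t) (ht : D.IsDummy t)
    (pid : Fin T.n → ℕ) (hinj : Function.Injective pid)
    (hlt : ∀ i i', T.ForcedLt i i' → pid i < pid i') : Run D (T.ring pid hinj) where
  k := T.k
  pos := T.k_pos
  conf := T.conf pid hinj
  trans j := T.row j.succ
  initial i := by
    refine ⟨?_, fun r => ?_⟩
    · change (T.lab i 0).1.tgt = _
      rw [hT.zero, ht.tgt]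
    · change pid (T.source 2 0 i r) = pid i
      rw [T.source_two_zero ht hT.zero]
  step j := by
    have hassign : ∀ i r, ((T.conf pid hinj j.succ).reg i r : ℕ) =
        (T.conf pid hinj j.castSucc).mid (T.row j.succ) i
          (((T.row j.succ i).1.update r).getD r) := by
      intro i r
      rw [T.mid_conf]
      change pid (T.source 2 j.succ i r) = _
      rw [T.source_two]
      rfl
    constructor
    · exact fun i => hT.next i j
    · exact fun i => rfl
    · intro i r r' h
      rw [← Subtype.coe_lt_coe, T.mid_conf, T.mid_conf]
      exact hlt _ _ ⟨(i, j.succ), r, r', h, rfl, rfl⟩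
    · intro i r r' h
      rw [Subtype.ext_iff, T.mid_conf, T.mid_conf, hT.eq i j.succ r r' h]
    · intro i r r' h
      rw [Subtype.ext_iff, hassign, show (T.row j.succ i).1.update r = some r' from h,
        Option.getD_some]
    · intro i r h
      have hu : (T.row j.succ i).1.update r = none :=
        Option.eq_none_iff_forall_ne_some.2 fun r' h' => h ⟨r', h'⟩
      rw [Subtype.ext_iff, hassign, hu, Option.getD_none]

variable {T : Table D}

theorem Table.Consistent.represents (hT : T.Consistent t) (ht : D.IsDummy t)
    {pid : Fin T.n → ℕ} (hinj : Function.Injective pid)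
    (hlt : ∀ i i', T.ForcedLt i i' → pid i < pid i') :
    Represents t (hT.run ht pid hinj hlt) ⟨0, T.n_pos⟩ (Equiv.refl _) T.lab where
  mark := rfl
  neighbor _ _ := Iff.rfl
  zero := hT.zero
  succ _ _ := rfl

/-- A restricted formula whose translation fails in a symbolic run fails in some run that the table
represents. -/
theorem Table.Consistent.exists_not_sat (hT : T.Consistent t) (ht : D.IsDummy t) :
    ∀ (φ : DForm D.S D.Reg), φ.Restricted D → ∀ x : Pos T.n T.k, ¬ φ.transl.Sat T x →
      ∃ (pid : Fin T.n → ℕ) (hinj : Function.Injective pid)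
        (hlt : ∀ i i', T.ForcedLt i i' → pid i < pid i'),
        ¬ φ.Sat (hT.run ht pid hinj hlt) ⟨0, T.n_pos⟩ x := by
  have plain : ∀ (φ : DForm D.S D.Reg), φ.NoOrder → ∀ x : Pos T.n T.k, ¬ φ.transl.Sat T x →
      ∃ (pid : Fin T.n → ℕ) (hinj : Function.Injective pid)
        (hlt : ∀ i i', T.ForcedLt i i' → pid i < pid i'),
        ¬ φ.Sat (hT.run ht pid hinj hlt) ⟨0, T.n_pos⟩ x := by
    intro φ hφ x hx
    obtain ⟨pid, hinj, hlt⟩ := exists_injective_strict hT.lt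
    exact ⟨pid, hinj, hlt,
      fun hs => hx ((φ.sat_transl_iff (hT.represents ht hinj hlt) ht hφ x).2 hs)⟩
  have order : ∀ (c : Cmp) (r r' : D.Reg) (π π' : DPath D.S D.Reg), π.NoOrder → π'.NoOrder →
      c.IsOrder → π.Unambiguous D → π'.Unambiguous D → ∀ x : Pos T.n T.k,
      ¬ (DForm.cmp c r r' π π').transl.Sat T x →
      ∃ (pid : Fin T.n → ℕ) (hinj : Function.Injective pid)
        (hlt : ∀ i i', T.ForcedLt i i' → pid i < pid i'),
        ¬ (DForm.cmp c r r' π π').Sat (hT.run ht pid hinj hlt) ⟨0, T.n_pos⟩ x := by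
    intro c r r' π π' hπ hπ' hc hu hu' x hx
    simp only [DForm.transl, LForm.Sat, LPath.Rel, not_exists, not_and, rel_evidence] at hx
    by_cases hex : ∃ y y', π.transl.Rel T x y ∧ π'.transl.Rel T x y'
    · obtain ⟨y, y', hy, hy'⟩ := hex
      have hf : ¬ c.Forced T (T.source 2 y.2 y.1 r) (T.source 2 y'.2 y'.1 r') :=
        fun hf => hx y hy y' hf hy'
      have hnt : ¬ TransGen T.ForcedLt (T.source 2 y.2 y.1 r) (T.source 2 y'.2 y'.1 r') := by
        cases c with
        | eq => exact hc.elim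
        | ne => exact hc.elim
        | lt => exact hf
        | le => exact fun h => hf (.inl h)
      obtain ⟨pid, hinj, hlt, hle⟩ := exists_injective_strict_le hT.lt hnt
      refine ⟨pid, hinj, hlt, ?_⟩
      have hrep := hT.represents ht hinj hlt
      simp only [DForm.Sat]
      rintro ⟨z, z', hz, hz', hcmp⟩
      obtain rfl := hu _ _ _ _ _ _ ((π.rel_transl_iff hrep ht hπ x y).1 hy) hz
      obtain rfl := hu' _ _ _ _ _ _ ((π'.rel_transl_iff hrep ht hπ' x y').1 hy') hz'
      cases c with
      | eq => exact hc
      | ne => exact hc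
      | lt => exact absurd hle (not_le.2 hcmp)
      | le =>
        have : pid (T.source 2 y.2 y.1 r) ≤ pid (T.source 2 y'.2 y'.1 r') := hcmp
        exact hf (.inr (hinj (this.antisymm hle)))
    · obtain ⟨pid, hinj, hlt⟩ := exists_injective_strict hT.lt
      refine ⟨pid, hinj, hlt, ?_⟩
      have hrep := hT.represents ht hinj hlt
      simp only [DForm.Sat]
      rintro ⟨z, z', hz, hz', _⟩
      exact hex ⟨z, z', (π.rel_transl_iff hrep ht hπ x z).2 hz,
        (π'.rel_transl_iff hrep ht hπ' x z').2 hz'⟩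
  let rec go : ∀ (φ : DForm D.S D.Reg), φ.Restricted D → ∀ x : Pos T.n T.k,
      ¬ φ.transl.Sat T x →
      ∃ (pid : Fin T.n → ℕ) (hinj : Function.Injective pid)
        (hlt : ∀ i i', T.ForcedLt i i' → pid i < pid i'),
        ¬ φ.Sat (hT.run ht pid hinj hlt) ⟨0, T.n_pos⟩ x
    | .mark, _, x, hx => plain .mark trivial x hx
    | .state s, _, x, hx => plain (.state s) trivial x hx
    | .neg φ, hφ, x, hx => plain (.neg φ) hφ x hx
    | .and φ φ', hφ, x, hx => by
      simp only [DForm.transl, LForm.Sat, not_and_or] at hx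
      rcases hx with hx | hx
      · obtain ⟨pid, hinj, hlt, h⟩ := go φ hφ.1 x hx
        exact ⟨pid, hinj, hlt, by simp only [DForm.Sat]; exact fun hs => h hs.1⟩
      · obtain ⟨pid, hinj, hlt, h⟩ := go φ' hφ.2 x hx
        exact ⟨pid, hinj, hlt, by simp only [DForm.Sat]; exact fun hs => h hs.2⟩
    | .imp φ φ', hφ, x, hx => by
      simp only [DForm.transl, LForm.sat_imp, Classical.not_imp] at hx
      obtain ⟨pid, hinj, hlt, h⟩ := go φ' hφ.2 x hx.2
      refine ⟨pid, hinj, hlt, ?_⟩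
      simp only [DForm.Sat]
      exact fun hs => h (hs ((φ.sat_transl_iff (hT.represents ht hinj hlt) ht hφ.1 x).1 hx.1))
    | .box π φ, hφ, x, hx => by
      simp only [DForm.transl, LForm.sat_box, not_forall] at hx
      obtain ⟨y, hy, hx⟩ := hx
      obtain ⟨pid, hinj, hlt, h⟩ := go φ hφ.2 y hx
      refine ⟨pid, hinj, hlt, ?_⟩
      simp only [DForm.Sat]
      exact fun hs => h (hs y ((π.rel_transl_iff (hT.represents ht hinj hlt) ht hφ.1 x y).1 hy))
    | .cmp c r r' π π', hφ, x, hx => by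
      by_cases hc : c.IsOrder
      · exact order c r r' π π' hφ.1 hφ.2.1 hc (hφ.2.2 hc).1 (hφ.2.2 hc).2 x hx
      · exact plain (.cmp c r r' π π') ⟨hc, hφ.1, hφ.2.1⟩ x hx
  exact go

/-- Symbolic runs that violate the translation correspond to runs that violate the formula. -/
theorem exists_mem_lang_iff (ht : D.IsDummy t) {φ : DForm D.S D.Reg} (hφ : φ.Restricted D) (k : ℕ) :
    (∃ T ∈ (LForm.and (psiAlg D t) (.neg φ.transl)).lang, T.k = k) ↔
      ∃ (R : PidRing) (χ : Run D R) (m : Fin R.n), χ.k = k ∧ ¬ φ.Sat χ m (m, 0) := by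
  have hmem : ∀ T : Table D, T ∈ (LForm.and (psiAlg D t) (.neg φ.transl)).lang ↔
      T.Consistent t ∧ ¬ φ.transl.Sat T (⟨0, T.n_pos⟩, 0) := by
    intro T
    rw [← sat_psiAlg]
    simp only [LForm.lang, Set.mem_ofPred_eq, LForm.Sat]
  constructor
  · rintro ⟨T, hT, rfl⟩
    obtain ⟨hT, hx⟩ := (hmem T).1 hT
    obtain ⟨pid, hinj, hlt, h⟩ := hT.exists_not_sat ht φ hφ _ hx
    exact ⟨_, hT.run ht pid hinj hlt, ⟨0, T.n_pos⟩, rfl, h⟩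
  · rintro ⟨R, χ, m, rfl, hχ⟩
    obtain ⟨e, lab, h⟩ := χ.exists_represents t m
    refine ⟨χ.table lab, (hmem _).2 ⟨h.consistent ht, fun hs => hχ ?_⟩, rfl⟩
    apply φ.sat_of_sat_transl h ht hφ
    have : rotate χ e (m, 0) = (⟨0, R.pos⟩, 0) := Prod.ext (Fin.ext h.mark) rfl
    rw [this]
    exact hs

end Realization

end RingAlg

/-- Correctness of the reduction from (round-bounded) model checking to emptiness for LCPDL. -/
theorem lemma3 (D : RingAlg.DistAlg) (t : D.Δ) (ht : D.IsDummy t)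
    (φ : RingAlg.DForm D.S D.Reg) (hφ : φ.Restricted D) (b : ℕ) (hb : 1 ≤ b) :
    (D.Models φ ↔
      (RingAlg.LForm.and (RingAlg.psiAlg D t) (.neg φ.transl)).lang = ∅) ∧
    (D.ModelsUpTo b φ ↔
      (RingAlg.LForm.and (RingAlg.psiAlg D t) (.neg φ.transl)).langUpTo b = ∅) := by
  have key := RingAlg.exists_mem_lang_iff ht hφ
  constructor
  · rw [Set.eq_empty_iff_forall_notMem]
    constructor
    · intro h T hT
      obtain ⟨R, χ, m, _, hχ⟩ := (key T.k).1 ⟨T, hT, rfl⟩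
      exact hχ (h R χ m)
    · intro h R χ m
      by_contra hχ
      obtain ⟨T, hT, _⟩ := (key χ.k).2 ⟨R, χ, m, rfl, hχ⟩
      exact h T hT
  · rw [Set.eq_empty_iff_forall_notMem]
    constructor
    · rintro h T ⟨hT, hk⟩
      obtain ⟨R, χ, m, hχk, hχ⟩ := (key T.k).1 ⟨T, hT, rfl⟩
      exact hχ (h R χ (hχk ▸ hk) m)
    · intro h R χ hk m
      by_contra hχ
      obtain ⟨T, hT, hTk⟩ := (key χ.k).2 ⟨R, χ, m, rfl, hχ⟩
      exact h T ⟨hT, hTk ▸ hk⟩
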